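/- Let $M$ be a smooth manifold of dimension $n\ge 2$, let $g$ be a smooth Lorentzian metric on $M$ with Levi-Civita connection $\nabla$, and let $\lambda\subset TM$ be a smooth distribution of lines that are null for $g$. **Group $GN$.** On $\mathbb R^n$ with standard basis $(k,l,m_1,\dots,m_{n-2})$ let $\eta$ be the symmetric bilinear form with $\eta(k,l)=1$, $\eta(m_i,m_j)=\delta_{ij}$ and all other products of basis vectors equal to $0$, and let $k^\perp$ be the $\eta$-orthogonal complement of $k$. $GN\subset GL(n,\mathbb R)$ is the group of invertible linear maps $f$ with $f(k)\in\mathbb Rk$, $\eta(f(w),f(w'))=\eta(w,w')$ for all $w,w'\in k^\perp$, and $\eta(f(k),f(z))=\eta(k,z)$ for all $z\in\mathbb R^n$. A $GN$-structure on $M$ is a smooth principal subbundle $P$ of the frame bundle of $M$ with structure group $GN$, a frame at $x$ being a linear isomorphism $u:\mathbb R^n\to T_xM$. Its associated distributions are $\lambda^P_x=u(\mathbb Rk)$ and $\Lambda^P_x=u(k^\perp)$, for any $u\in P_x$. **Kundt structures.** A vector field $X$ on an open set $U$ is an infinitesimal automorphism of $P$ over $U$ if the maps $\phi_t$ of its local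 flow carry frames belonging to $P$ to frames belonging to $P$. A $GN$-structure $P$ is a *Kundt structure* if $\Lambda^P$ is integrable and every point of $M$ has an open neighbourhood $U$ with a nowhere vanishing smooth vector field $X$ on $U$ which takes values in $\lambda^P$ and is an infinitesimal automorphism of $P$ over $U$. **Kundt spacetimes.** $(M,g,\lambda)$ is a *Kundt spacetime* if $\lambda^\perp$ is integrable and every point of $M$ has an open neighbourhood with a nowhere vanishing smooth vector field $X$ on it which takes values in $\lambda$ and satisfies $$\nabla_XX=0,\qquad \nabla_{(a}X_{b)}\nabla^aX^b=0,\qquad \nabla_aX^a=0 .$$ **Induced structure.** The metric $g$ induces a bilinear form $g^\perp([w],[w'])=g(w,w')$ on $\lambda^\perp/\lambda$ and a linear form $f(v\otimes[z])=g(v,z)$ on $\lambda\otimes TM/\lambda^\perp$. Let $P(M,g,\lambda)$ be the set of all frames $(X,Y,Z_1,\dots,Z_{n-2})$ of tangent spaces of $M$ (the images of $k,l,m_1,\dots,m_{n-2}$) such that $X\in\lambda$, $f(X\otimes[Y])=1$, $Z_i\in\lambda^\perp$ and $g^\perp([Z_i],[Z_j])=\delta_{ij}$ for all $i,j$. **Statement.**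 If $(M,g,\lambda)$ is a Kundt spacetime, then $P(M,g,\lambda)$ is a $GN$-structure and it is a Kundt structure. -/

import Mathlib

open Set Bundle VectorField
open scoped Manifold ContDiff Topology

noncomputable section

/-! ## The structure group `GN`

The dimension is `n = m + 2`, and the standard basis of `ℝⁿ` is written
`k = e₀`, `l = e₁`, `mᵢ = e_{i+2}`. -/

/-- The Minkowski inner product
`η = ω¹ ⊗ ω² + ω² ⊗ ω¹ + ω³ ⊗ ω³ + ⋯ + ωⁿ ⊗ ωⁿ` on `ℝⁿ`, `n = m + 2`. -/
def minkowski {m : ℕ} (v w : Fin (m + 2) → ℝ) : ℝ :=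
  v 0 * w 1 + v 1 * w 0 + ∑ i : Fin m, v i.succ.succ * w i.succ.succ

/-- The null vector `k`. -/
def nullK (m : ℕ) : Fin (m + 2) → ℝ := Pi.single 0 1

/-- The null vector `l`. -/
def nullL (m : ℕ) : Fin (m + 2) → ℝ := Pi.single 1 1

/-- The spacelike vectors `mᵢ`. -/
def spaceM {m : ℕ} (i : Fin m) : Fin (m + 2) → ℝ := Pi.single i.succ.succ 1

theorem minkowski_smul_left {m : ℕ} (c : ℝ) (v w : Fin (m + 2) → ℝ) :
    minkowski (c • v) w = c * minkowski v w := by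
  simp only [minkowski, Pi.smul_apply, smul_eq_mul, mul_add, Finset.mul_sum]
  simp only [mul_assoc]

theorem minkowski_nullK_left {m : ℕ} (w : Fin (m + 2) → ℝ) : minkowski (nullK m) w = w 1 := by
  simp [minkowski, nullK, Fin.ext_iff]

/-- The line `ℝ k` in `ℝⁿ`. -/
def lineK (m : ℕ) : Submodule ℝ (Fin (m + 2) → ℝ) := Submodule.span ℝ {nullK m}

/-- The hyperplane `k^⊥` in `ℝⁿ`. -/
def perpK (m : ℕ) : Submodule ℝ (Fin (m + 2) → ℝ) where
  carrier := {w | minkowski (nullK m) w = 0}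
  add_mem' {a b} ha hb := by
    simp only [Set.mem_ofPred_eq, minkowski_nullK_left, Pi.add_apply] at *
    rw [ha, hb, add_zero]
  zero_mem' := by simp [minkowski_nullK_left]
  smul_mem' c a ha := by
    simp only [Set.mem_ofPred_eq, minkowski_nullK_left, Pi.smul_apply, smul_eq_mul] at *
    rw [ha, mul_zero]

/-- The defining conditions of `GN` on an invertible linear map `f` of `ℝⁿ`. -/
structure IsGN {m : ℕ} (f : (Fin (m + 2) → ℝ) ≃ₗ[ℝ] (Fin (m + 2) → ℝ)) : Prop where
  map_k : f (nullK m) ∈ lineK m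
  perp : ∀ w ∈ perpK m, ∀ w' ∈ perpK m, minkowski (f w) (f w') = minkowski w w'
  pairing : ∀ z, minkowski (f (nullK m)) (f z) = minkowski (nullK m) z

theorem IsGN.exists_scale {m : ℕ} {f : (Fin (m + 2) → ℝ) ≃ₗ[ℝ] (Fin (m + 2) → ℝ)}
    (hf : IsGN f) : ∃ c : ℝ, c ≠ 0 ∧ f (nullK m) = c • nullK m := by
  obtain ⟨c, hc⟩ := Submodule.mem_span_singleton.1 hf.map_k
  refine ⟨c, ?_, hc.symm⟩
  rintro rfl
  have h0 : f (nullK m) = 0 := by rw [← hc, zero_smul]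
  have h1 : nullK m = 0 := by simpa using h0
  have := congrFun h1 0
  simp [nullK] at this

theorem IsGN.mem_perp {m : ℕ} {f : (Fin (m + 2) → ℝ) ≃ₗ[ℝ] (Fin (m + 2) → ℝ)}
    (hf : IsGN f) {w : Fin (m + 2) → ℝ} : f w ∈ perpK m ↔ w ∈ perpK m := by
  obtain ⟨c, hc, hfc⟩ := hf.exists_scale
  have h := hf.pairing w
  rw [hfc, minkowski_smul_left] at h
  change minkowski (nullK m) (f w) = 0 ↔ minkowski (nullK m) w = 0
  rw [← h, mul_eq_zero, or_iff_right hc]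

/-- The group `GN ⊂ GL(n, ℝ)`. -/
def GN (m : ℕ) : Subgroup ((Fin (m + 2) → ℝ) ≃ₗ[ℝ] (Fin (m + 2) → ℝ)) where
  carrier := {f | IsGN f}
  one_mem' :=
    ⟨Submodule.mem_span_singleton_self _, fun _ _ _ _ => rfl, fun _ => rfl⟩
  mul_mem' {f h} hf hh := by
    obtain ⟨c, -, hc⟩ := hf.exists_scale
    obtain ⟨d, -, hd⟩ := hh.exists_scale
    refine ⟨?_, fun w hw w' hw' => ?_, fun z => ?_⟩
    · rw [LinearEquiv.mul_apply, hd, map_smul, hc]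
      exact Submodule.smul_mem _ _ (Submodule.smul_mem _ _ (Submodule.mem_span_singleton_self _))
    · rw [LinearEquiv.mul_apply, LinearEquiv.mul_apply,
        hf.perp _ (hh.mem_perp.2 hw) _ (hh.mem_perp.2 hw'), hh.perp _ hw _ hw']
    · rw [LinearEquiv.mul_apply, LinearEquiv.mul_apply, ← hh.pairing z, hd, map_smul,
        minkowski_smul_left, minkowski_smul_left, hf.pairing]
  inv_mem' {f} hf := by
    obtain ⟨c, hc0, hc⟩ := hf.exists_scale
    have hk : f⁻¹ (nullK m) = c⁻¹ • nullK m := by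
      apply f.injective
      rw [map_smul, hc, smul_smul, inv_mul_cancel₀ hc0, one_smul]
      exact f.apply_symm_apply _
    have hff : ∀ z, f (f⁻¹ z) = z := fun z => f.apply_symm_apply z
    refine ⟨?_, fun w hw w' hw' => ?_, fun z => ?_⟩
    · rw [hk]
      exact Submodule.smul_mem _ _ (Submodule.mem_span_singleton_self _)
    · rw [← hf.perp _ (hf.mem_perp.1 (by rwa [hff])) _ (hf.mem_perp.1 (by rwa [hff])), hff, hff]
    · rw [hk, minkowski_smul_left, ← hf.pairing, hff, hc, minkowski_smul_left, ← mul_assoc,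
        inv_mul_cancel₀ hc0, one_mul]

/-! ## Distributions, frames and `G`-structures -/

section Manifold

variable {m : ℕ} {M : Type*} [TopologicalSpace M]
  [ChartedSpace (EuclideanSpace ℝ (Fin (m + 2))) M] [IsManifold (𝓡 (m + 2)) ∞ M]

/-- A vector field is smooth on the set `U` (its values off `U` are irrelevant). -/
def SmoothFieldOn (X : ∀ x : M, TangentSpace (𝓡 (m + 2)) x) (U : Set M) : Prop :=
  ContMDiffOn (𝓡 (m + 2)) (𝓡 (m + 2)).tangent ∞
    (fun x => (⟨x, X x⟩ : TangentBundle (𝓡 (m + 2)) M)) U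

/-- A vector field is differentiable at the point `x`. -/
abbrev DiffFieldAt (X : ∀ x : M, TangentSpace (𝓡 (m + 2)) x) (x : M) : Prop :=
  MDifferentiableAt (𝓡 (m + 2)) (𝓡 (m + 2)).tangent
    (fun x => (⟨x, X x⟩ : TangentBundle (𝓡 (m + 2)) M)) x

/-- A smooth distribution of rank `r`: it is spanned near each point by `r` smooth, pointwise
linearly independent vector fields. -/
def IsSmoothDistribution (r : ℕ) (D : ∀ x : M, Submodule ℝ (TangentSpace (𝓡 (m + 2)) x)) : Prop :=
  ∀ p : M, ∃ U : Set M, IsOpen U ∧ p ∈ U ∧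
    ∃ X : Fin r → ∀ x : M, TangentSpace (𝓡 (m + 2)) x,
      (∀ i, SmoothFieldOn (X i) U) ∧
      ∀ x ∈ U, LinearIndependent ℝ (fun i => X i x) ∧
        Submodule.span ℝ (Set.range fun i => X i x) = D x

/-- Integrability of a distribution, in Frobenius' form: the Lie bracket of two local smooth
sections is again a section. -/
def IsIntegrableDistribution (D : ∀ x : M, Submodule ℝ (TangentSpace (𝓡 (m + 2)) x)) : Prop :=
  ∀ U : Set M, IsOpen U → ∀ X Y : ∀ x : M, TangentSpace (𝓡 (m + 2)) x,
    SmoothFieldOn X U → SmoothFieldOn Y U →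
    (∀ x ∈ U, X x ∈ D x) → (∀ x ∈ U, Y x ∈ D x) →
    ∀ x ∈ U, mlieBracket (𝓡 (m + 2)) X Y x ∈ D x

variable (m M) in
/-- A subset of the frame bundle of `M`, given fibre by fibre. A frame at `x` is a linear
isomorphism `ℝⁿ → T_x M`. -/
abbrev FrameSet : Type _ :=
  ∀ x : M, Set ((Fin (m + 2) → ℝ) ≃ₗ[ℝ] TangentSpace (𝓡 (m + 2)) x)

/-- `P` is a `G`-structure: a smooth principal subbundle of the frame bundle with structure group
`G`. The right action is `u · a = u ∘ a` (it is automatically free), `G` acts transitively on the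
fibres, and `P` has smooth local sections around each point (so that its fibres are nonempty). -/
structure IsGStructure (G : Subgroup ((Fin (m + 2) → ℝ) ≃ₗ[ℝ] (Fin (m + 2) → ℝ)))
    (P : FrameSet m M) : Prop where
  right_invariant : ∀ x, ∀ u ∈ P x, ∀ a ∈ G, a.trans u ∈ P x
  transitive : ∀ x, ∀ u ∈ P x, ∀ u' ∈ P x, ∃ a ∈ G, u' = a.trans u
  local_sections : ∀ p : M, ∃ U : Set M, IsOpen U ∧ p ∈ U ∧
    ∃ s : ∀ x : M, (Fin (m + 2) → ℝ) ≃ₗ[ℝ] TangentSpace (𝓡 (m + 2)) x,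
      (∀ x ∈ U, s x ∈ P x) ∧ ∀ v, SmoothFieldOn (fun x => s x v) U

/-- The line field `λ_x = u(ℝ k)`, `u ∈ P_x`, associated with a `GN`-structure `P`. (On a
`GN`-structure all `u ∈ P_x` give the same line.) -/
def assocLine (P : FrameSet m M) (x : M) : Submodule ℝ (TangentSpace (𝓡 (m + 2)) x) :=
  ⨆ u ∈ P x, (lineK m).map u.toLinearMap

/-- The hyperplane field `Λ_x = u(k^⊥)`, `u ∈ P_x`, associated with a `GN`-structure `P`. -/
def assocHyperplane (P : FrameSet m M) (x : M) : Submodule ℝ (TangentSpace (𝓡 (m + 2)) x) :=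
  ⨆ u ∈ P x, (perpK m).map u.toLinearMap

/-- `φ` is a smooth flow of the vector field `X` (living on `U`), for times in the open
interval `J ∋ 0` and initial points in the open set `V`. -/
structure IsLocalFlow (X : ∀ x : M, TangentSpace (𝓡 (m + 2)) x) (U : Set M)
    (J : Set ℝ) (V : Set M) (φ : ℝ → M → M) : Prop where
  isOpen_time : IsOpen J
  ordConnected_time : J.OrdConnected
  zero_mem : (0 : ℝ) ∈ J
  isOpen_space : IsOpen V
  subset : V ⊆ U
  mapsTo : ∀ t ∈ J, ∀ y ∈ V, φ t y ∈ U
  initial : ∀ y ∈ V, φ 0 y = y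
  integralCurve : ∀ y ∈ V, IsMIntegralCurveOn (I := 𝓡 (m + 2)) (fun t => φ t y) X J
  smooth : ContMDiffOn (𝓘(ℝ, ℝ).prod (𝓡 (m + 2))) (𝓡 (m + 2)) ∞
    (fun q : ℝ × M => φ q.1 q.2) (J ×ˢ V)

/-- The vector field `X` on `U` is an infinitesimal automorphism of `P` over `U`: each map `φ_t` of
each local flow of `X` carries frames of `P` to frames of `P`. -/
def IsInfinitesimalAutomorphismOn (P : FrameSet m M)
    (X : ∀ x : M, TangentSpace (𝓡 (m + 2)) x) (U : Set M) : Prop :=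
  ∀ (J : Set ℝ) (V : Set M) (φ : ℝ → M → M), IsLocalFlow X U J V φ →
    ∀ t ∈ J, ∀ y ∈ V, ∀ u ∈ P y, ∃ u' ∈ P (φ t y),
      ∀ v, u' v = mfderiv (𝓡 (m + 2)) (𝓡 (m + 2)) (φ t) y (u v)

/-- A Kundt structure: a `GN`-structure such that `Λ` is integrable and about each point there is
a (nowhere vanishing) local vector field in `λ` which is an infinitesimal automorphism of `P`. -/
structure IsKundtStructure (P : FrameSet m M) : Prop where
  isGStructure : IsGStructure (GN m) P
  integrable : IsIntegrableDistribution (assocHyperplane P)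
  exists_automorphism : ∀ p : M, ∃ U : Set M, IsOpen U ∧ p ∈ U ∧
    ∃ X : ∀ x : M, TangentSpace (𝓡 (m + 2)) x, SmoothFieldOn X U ∧
      (∀ x ∈ U, X x ≠ 0) ∧ (∀ x ∈ U, X x ∈ assocLine P x) ∧
      IsInfinitesimalAutomorphismOn P X U

/-! ## Lorentzian metrics and null distributions -/

variable (m M) in
/-- A smooth Lorentzian metric on `M`, `dim M = m + 2`: a smooth symmetric bilinear form such that
each tangent space is isometric to `(ℝⁿ, η)`. -/
structure LorentzianMetric where
  inner : ∀ x : M, TangentSpace (𝓡 (m + 2)) x →L[ℝ] TangentSpace (𝓡 (m + 2)) x →L[ℝ] ℝ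
  symm : ∀ (x : M) (v w : TangentSpace (𝓡 (m + 2)) x), inner x v w = inner x w v
  signature : ∀ x : M, ∃ u : (Fin (m + 2) → ℝ) ≃ₗ[ℝ] TangentSpace (𝓡 (m + 2)) x,
    ∀ v w, inner x (u v) (u w) = minkowski v w
  contMDiff : ContMDiff (𝓡 (m + 2))
    ((𝓡 (m + 2)).prod 𝓘(ℝ, EuclideanSpace ℝ (Fin (m + 2)) →L[ℝ]
      EuclideanSpace ℝ (Fin (m + 2)) →L[ℝ] ℝ)) ∞
    (fun x : M => TotalSpace.mk' (EuclideanSpace ℝ (Fin (m + 2)) →L[ℝ]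
      EuclideanSpace ℝ (Fin (m + 2)) →L[ℝ] ℝ) x (inner x))

/-- A null distribution of `g`: a smooth line field consisting of null vectors. -/
structure IsNullDistribution (g : LorentzianMetric m M)
    (lam : ∀ x : M, Submodule ℝ (TangentSpace (𝓡 (m + 2)) x)) : Prop where
  smooth : IsSmoothDistribution 1 lam
  null : ∀ x, ∀ v ∈ lam x, g.inner x v v = 0

/-- The orthogonal complement `D^⊥` of a distribution with respect to `g`. -/
def perpDistribution (g : LorentzianMetric m M)
    (D : ∀ x : M, Submodule ℝ (TangentSpace (𝓡 (m + 2)) x)) (x : M) :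
    Submodule ℝ (TangentSpace (𝓡 (m + 2)) x) where
  carrier := {w | ∀ v ∈ D x, g.inner x v w = 0}
  add_mem' {a b} ha hb v hv := by rw [map_add, ha v hv, hb v hv, add_zero]
  zero_mem' v _ := map_zero _
  smul_mem' c a ha v hv := by rw [map_smul, ha v hv, smul_zero]

/-! ## The `GN`-structure induced by a metric and a null distribution -/

/-- The bilinear form `g^⊥` induced by `g` on `λ^⊥/λ`: `g^⊥([w], [w']) = g(w, w')`. -/
def inducedPerp (g : LorentzianMetric m M)
    (lam : ∀ x : M, Submodule ℝ (TangentSpace (𝓡 (m + 2)) x)) (x : M) :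
    (perpDistribution g lam x ⧸ (lam x).submoduleOf (perpDistribution g lam x)) →ₗ[ℝ]
    (perpDistribution g lam x ⧸ (lam x).submoduleOf (perpDistribution g lam x)) →ₗ[ℝ] ℝ :=
  Submodule.liftQ _
    (LinearMap.mk₂ ℝ
      (fun (w : perpDistribution g lam x)
        (q : perpDistribution g lam x ⧸ (lam x).submoduleOf (perpDistribution g lam x)) =>
        Submodule.liftQ ((lam x).submoduleOf (perpDistribution g lam x))
          ((g.inner x w).toLinearMap ∘ₗ (perpDistribution g lam x).subtype)
          (fun v hv => by
            change g.inner x w v = 0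
            rw [g.symm]
            exact w.2 v hv) q)
      (fun w w' q => by
        obtain ⟨z, rfl⟩ := Submodule.mkQ_surjective _ q
        simp)
      (fun c w q => by
        obtain ⟨z, rfl⟩ := Submodule.mkQ_surjective _ q
        simp)
      (fun w q q' => map_add _ q q')
      (fun c w q => map_smul _ c q))
    (fun v hv => by
      ext z
      exact z.2 v hv)

/-- The form `f` induced by `g` on `λ ⊗ TM/λ^⊥`, as a bilinear map: `f(v ⊗ [z]) = g(v, z)`. -/
def inducedPairing (g : LorentzianMetric m M)
    (lam : ∀ x : M, Submodule ℝ (TangentSpace (𝓡 (m + 2)) x)) (x : M) :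
    lam x →ₗ[ℝ] (TangentSpace (𝓡 (m + 2)) x ⧸ perpDistribution g lam x) →ₗ[ℝ] ℝ :=
  LinearMap.mk₂ ℝ
    (fun (v : lam x) (q : TangentSpace (𝓡 (m + 2)) x ⧸ perpDistribution g lam x) =>
      Submodule.liftQ (perpDistribution g lam x) (g.inner x v).toLinearMap
        (fun w hw => hw v v.2) q)
    (fun v v' q => by
      obtain ⟨z, rfl⟩ := Submodule.mkQ_surjective _ q
      change g.inner x (v + v' : lam x) z = g.inner x v z + g.inner x v' z
      simp)
    (fun c v q => by
      obtain ⟨z, rfl⟩ := Submodule.mkQ_surjective _ q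
      change g.inner x (c • v : lam x) z = c • g.inner x v z
      simp)
    (fun v q q' => map_add _ q q')
    (fun c v q => map_smul _ c q)

/-- The `GN`-structure `P(M, g, λ)` induced by a metric `g` and a null distribution `λ`, i.e. the
one of the null-quadruple `(λ, λ^⊥, g^⊥, f)`. Its fibre at `x` consists of the frames
`(X, Y, Zᵢ)` such that `X ∈ λ`, `f(X ⊗ [Y]) = 1`, `Zᵢ ∈ λ^⊥` and the classes of the `Zᵢ` are
orthonormal for `g^⊥`. -/
def inducedGNStructure (g : LorentzianMetric m M)
    (lam : ∀ x : M, Submodule ℝ (TangentSpace (𝓡 (m + 2)) x)) : FrameSet m M := fun x =>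
  {u | (∃ hX : u (nullK m) ∈ lam x,
          inducedPairing g lam x ⟨u (nullK m), hX⟩ (Submodule.Quotient.mk (u (nullL m))) = 1) ∧
        ∃ hZ : ∀ i : Fin m, u (spaceM i) ∈ perpDistribution g lam x,
          ∀ i j : Fin m, inducedPerp g lam x (Submodule.Quotient.mk ⟨u (spaceM i), hZ i⟩)
            (Submodule.Quotient.mk ⟨u (spaceM j), hZ j⟩) = if i = j then 1 else 0}

/-! ## The Levi-Civita connection -/

/-- `∇` is torsion-free and metric for `g`. Here `cov Y x (X x)` is `(∇_X Y)(x)`. -/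
structure IsLeviCivita (g : LorentzianMetric m M)
    (cov : CovariantDerivative (𝓡 (m + 2)) (EuclideanSpace ℝ (Fin (m + 2)))
      (TangentSpace (𝓡 (m + 2)) : M → Type _)) : Prop where
  torsion_free : ∀ (X Y : ∀ x : M, TangentSpace (𝓡 (m + 2)) x) (x : M),
    DiffFieldAt X x → DiffFieldAt Y x →
      cov Y x (X x) - cov X x (Y x) = mlieBracket (𝓡 (m + 2)) X Y x
  metric : ∀ (X Y Z : ∀ x : M, TangentSpace (𝓡 (m + 2)) x) (x : M),
    DiffFieldAt Y x → DiffFieldAt Z x →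
      mvfderiv (𝓡 (m + 2)) (fun y => g.inner y (Y y) (Z y)) x (X x) =
        g.inner x (cov Y x (X x)) (Z x) + g.inner x (Y x) (cov Z x (X x))

theorem LorentzianMetric.mdiffAt (g : LorentzianMetric m M)
    {Y Z : ∀ x : M, TangentSpace (𝓡 (m + 2)) x} {x : M}
    (hY : DiffFieldAt Y x) (hZ : DiffFieldAt Z x) :
    MDifferentiableAt (𝓡 (m + 2)) 𝓘(ℝ, ℝ) (fun y => g.inner y (Y y) (Z y)) x := by
  have : MDifferentiableAt (𝓡 (m + 2)) ((𝓡 (m + 2)).prod 𝓘(ℝ))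
      (fun y => TotalSpace.mk' ℝ (E := Bundle.Trivial M ℝ) y (g.inner y (Y y) (Z y))) x := by
    apply MDifferentiableAt.clm_bundle_apply₂ (F₁ := EuclideanSpace ℝ (Fin (m + 2)))
      (F₂ := EuclideanSpace ℝ (Fin (m + 2)))
    · exact g.contMDiff.mdifferentiableAt (by simp)
    · exact hY
    · exact hZ
  simp only [mdifferentiableAt_totalSpace] at this
  exact this.2

/-- The right-hand side of the Koszul formula for `2 g(∇_X Y, Z)`. -/
def koszul (g : LorentzianMetric m M) (X Y Z : ∀ x : M, TangentSpace (𝓡 (m + 2)) x) (x : M) : ℝ :=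
  mvfderiv (𝓡 (m + 2)) (fun y => g.inner y (Y y) (Z y)) x (X x) +
  mvfderiv (𝓡 (m + 2)) (fun y => g.inner y (Z y) (X y)) x (Y x) -
  mvfderiv (𝓡 (m + 2)) (fun y => g.inner y (X y) (Y y)) x (Z x) +
  g.inner x (mlieBracket (𝓡 (m + 2)) X Y x) (Z x) -
  g.inner x (mlieBracket (𝓡 (m + 2)) Y Z x) (X x) +
  g.inner x (mlieBracket (𝓡 (m + 2)) Z X x) (Y x)

section

variable (g : LorentzianMetric m M) {X X' Y Y' Z Z' : ∀ x : M, TangentSpace (𝓡 (m + 2)) x}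
  {f : M → ℝ} {x : M}

theorem LorentzianMetric.deriv_smul_left (hf : MDifferentiableAt (𝓡 (m + 2)) 𝓘(ℝ, ℝ) f x)
    (hY : DiffFieldAt Y x) (hZ : DiffFieldAt Z x) (v : TangentSpace (𝓡 (m + 2)) x) :
    mvfderiv (𝓡 (m + 2)) (fun y => g.inner y ((f • Y) y) (Z y)) x v =
      f x * mvfderiv (𝓡 (m + 2)) (fun y => g.inner y (Y y) (Z y)) x v +
      mvfderiv (𝓡 (m + 2)) f x v * g.inner x (Y x) (Z x) := by
  have : (fun y => g.inner y ((f • Y) y) (Z y)) = f * (fun y => g.inner y (Y y) (Z y)) := by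
    ext y; simp
  rw [this, mvfderiv_mul hf (g.mdiffAt hY hZ)]
  simp
  ring

theorem LorentzianMetric.deriv_smul_right (hf : MDifferentiableAt (𝓡 (m + 2)) 𝓘(ℝ, ℝ) f x)
    (hY : DiffFieldAt Y x) (hZ : DiffFieldAt Z x) (v : TangentSpace (𝓡 (m + 2)) x) :
    mvfderiv (𝓡 (m + 2)) (fun y => g.inner y (Y y) ((f • Z) y)) x v =
      f x * mvfderiv (𝓡 (m + 2)) (fun y => g.inner y (Y y) (Z y)) x v +
      mvfderiv (𝓡 (m + 2)) f x v * g.inner x (Y x) (Z x) := by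
  have : (fun y => g.inner y (Y y) ((f • Z) y)) = f * (fun y => g.inner y (Y y) (Z y)) := by
    ext y; simp
  rw [this, mvfderiv_mul hf (g.mdiffAt hY hZ)]
  simp
  ring

theorem LorentzianMetric.deriv_add_left
    (hY : DiffFieldAt Y x) (hY' : DiffFieldAt Y' x) (hZ : DiffFieldAt Z x)
    (v : TangentSpace (𝓡 (m + 2)) x) :
    mvfderiv (𝓡 (m + 2)) (fun y => g.inner y ((Y + Y') y) (Z y)) x v =
      mvfderiv (𝓡 (m + 2)) (fun y => g.inner y (Y y) (Z y)) x v +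
      mvfderiv (𝓡 (m + 2)) (fun y => g.inner y (Y' y) (Z y)) x v := by
  have : (fun y => g.inner y ((Y + Y') y) (Z y)) =
      (fun y => g.inner y (Y y) (Z y)) + (fun y => g.inner y (Y' y) (Z y)) := by
    ext y; simp
  rw [this, mvfderiv_add (g.mdiffAt hY hZ) (g.mdiffAt hY' hZ)]
  simp

theorem LorentzianMetric.deriv_add_right
    (hY : DiffFieldAt Y x) (hZ : DiffFieldAt Z x) (hZ' : DiffFieldAt Z' x)
    (v : TangentSpace (𝓡 (m + 2)) x) :
    mvfderiv (𝓡 (m + 2)) (fun y => g.inner y (Y y) ((Z + Z') y)) x v =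
      mvfderiv (𝓡 (m + 2)) (fun y => g.inner y (Y y) (Z y)) x v +
      mvfderiv (𝓡 (m + 2)) (fun y => g.inner y (Y y) (Z' y)) x v := by
  have : (fun y => g.inner y (Y y) ((Z + Z') y)) =
      (fun y => g.inner y (Y y) (Z y)) + (fun y => g.inner y (Y y) (Z' y)) := by
    ext y; simp
  rw [this, mvfderiv_add (g.mdiffAt hY hZ) (g.mdiffAt hY hZ')]
  simp

theorem koszul_smul_left (hf : MDifferentiableAt (𝓡 (m + 2)) 𝓘(ℝ, ℝ) f x) (hX : DiffFieldAt X x) (hY : DiffFieldAt Y x)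
    (hZ : DiffFieldAt Z x) : koszul g (f • X) Y Z x = f x • koszul g X Y Z x := by
  simp only [koszul, g.deriv_smul_left hf hX hY, g.deriv_smul_right hf hZ hX,
    mlieBracket_smul_left hf hX, mlieBracket_smul_right hf hX]
  simp only [Pi.smul_apply', map_smul, map_add, map_neg, neg_smul, _root_.add_apply,
    _root_.smul_apply, _root_.neg_apply, smul_eq_mul]
  rw [g.symm x (X x) (Z x)]
  ring

theorem koszul_smul_right (hf : MDifferentiableAt (𝓡 (m + 2)) 𝓘(ℝ, ℝ) f x) (hX : DiffFieldAt X x) (hY : DiffFieldAt Y x)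
    (hZ : DiffFieldAt Z x) : koszul g X Y (f • Z) x = f x • koszul g X Y Z x := by
  simp only [koszul, g.deriv_smul_left hf hZ hX, g.deriv_smul_right hf hY hZ,
    mlieBracket_smul_left hf hZ, mlieBracket_smul_right hf hZ]
  simp only [Pi.smul_apply', map_smul, map_add, map_neg, neg_smul, _root_.add_apply,
    _root_.smul_apply, _root_.neg_apply, smul_eq_mul]
  rw [g.symm x (Y x) (Z x)]
  ring

theorem koszul_smul_mid (hf : MDifferentiableAt (𝓡 (m + 2)) 𝓘(ℝ, ℝ) f x) (hX : DiffFieldAt X x) (hY : DiffFieldAt Y x)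
    (hZ : DiffFieldAt Z x) : koszul g X (f • Y) Z x =
      f x * koszul g X Y Z x + 2 * (mvfderiv (𝓡 (m + 2)) f x (X x) * g.inner x (Y x) (Z x)) := by
  simp only [koszul, g.deriv_smul_left hf hY hZ, g.deriv_smul_right hf hX hY,
    mlieBracket_smul_left hf hY, mlieBracket_smul_right hf hY]
  simp only [Pi.smul_apply', map_smul, map_add, map_neg, neg_smul, _root_.add_apply,
    _root_.smul_apply, _root_.neg_apply, smul_eq_mul]
  rw [g.symm x (X x) (Y x)]
  ring

theorem koszul_add_left (hX : DiffFieldAt X x) (hX' : DiffFieldAt X' x) (hY : DiffFieldAt Y x)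
    (hZ : DiffFieldAt Z x) :
    koszul g (X + X') Y Z x = koszul g X Y Z x + koszul g X' Y Z x := by
  simp only [koszul, g.deriv_add_left hX hX' hY, g.deriv_add_right hZ hX hX',
    mlieBracket_add_left hX hX', mlieBracket_add_right hX hX']
  simp only [Pi.add_apply, map_add, _root_.add_apply]
  ring

theorem koszul_add_right (hX : DiffFieldAt X x) (hY : DiffFieldAt Y x) (hZ : DiffFieldAt Z x)
    (hZ' : DiffFieldAt Z' x) :
    koszul g X Y (Z + Z') x = koszul g X Y Z x + koszul g X Y Z' x := by
  simp only [koszul, g.deriv_add_left hZ hZ' hX, g.deriv_add_right hY hZ hZ',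
    mlieBracket_add_left hZ hZ', mlieBracket_add_right hZ hZ']
  simp only [Pi.add_apply, map_add, _root_.add_apply]
  ring

theorem koszul_add_mid (hX : DiffFieldAt X x) (hY : DiffFieldAt Y x) (hY' : DiffFieldAt Y' x)
    (hZ : DiffFieldAt Z x) :
    koszul g X (Y + Y') Z x = koszul g X Y Z x + koszul g X Y' Z x := by
  simp only [koszul, g.deriv_add_left hY hY' hZ, g.deriv_add_right hX hY hY',
    mlieBracket_add_left hY hY', mlieBracket_add_right hY hY']
  simp only [Pi.add_apply, map_add, _root_.add_apply]
  ring

/-- For `Y` differentiable at `x`, the bilinear form `(X, Z) ↦ 2 g(∇_X Y, Z)` on `T_x M`. -/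
def koszulForm (hY : DiffFieldAt Y x) :
    TangentSpace (𝓡 (m + 2)) x →L[ℝ] TangentSpace (𝓡 (m + 2)) x →L[ℝ] ℝ :=
  TensorialAt.mkHom₂ (I := 𝓡 (m + 2)) (F := EuclideanSpace ℝ (Fin (m + 2)))
    (F' := EuclideanSpace ℝ (Fin (m + 2)))
    (V := (TangentSpace (𝓡 (m + 2)) : M → Type _))
    (V' := (TangentSpace (𝓡 (m + 2)) : M → Type _))
    (fun X Z => koszul g X Y Z x) x
    (fun _ hZ => ⟨fun hf hX => koszul_smul_left g hf hX hY hZ,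
      fun hX hX' => koszul_add_left g hX hX' hY hZ⟩)
    (fun _ hX => ⟨fun hf hZ => koszul_smul_right g hf hX hY hZ,
      fun hZ hZ' => koszul_add_right g hX hY hZ hZ'⟩)

theorem koszulForm_apply (hX : DiffFieldAt X x) (hY : DiffFieldAt Y x) (hZ : DiffFieldAt Z x) :
    koszulForm g hY (X x) (Z x) = koszul g X Y Z x :=
  TensorialAt.mkHom₂_apply _ _ hX hZ

end

theorem minkowski_single_succ_succ {m : ℕ} (i : Fin m) (w : Fin (m + 2) → ℝ) :
    minkowski (spaceM i) w = w i.succ.succ := by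
  have h1 : (1 : Fin (m + 2)) ≠ i.succ.succ := by simp [Fin.ext_iff]
  simp [minkowski, spaceM, Pi.single_apply, h1]

theorem minkowski_nullL_left {m : ℕ} (w : Fin (m + 2) → ℝ) : minkowski (nullL m) w = w 0 := by
  simp [minkowski, nullL, Fin.ext_iff]

theorem LorentzianMetric.nondegenerate (g : LorentzianMetric m M) (x : M)
    {v : TangentSpace (𝓡 (m + 2)) x} (hv : ∀ w, g.inner x v w = 0) : v = 0 := by
  obtain ⟨u, hu⟩ := g.signature x
  obtain ⟨a, rfl⟩ := u.surjective v
  have h : ∀ b, minkowski b a = 0 := fun b => by rw [← hu, g.symm]; exact hv (u b)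
  have ha : a = 0 := by
    ext i
    refine Fin.cases ?_ (fun j => Fin.cases ?_ (fun k => ?_) j) i
    · simpa [minkowski_nullL_left] using h (nullL m)
    · simpa [minkowski_nullK_left] using h (nullK m)
    · simpa [minkowski_single_succ_succ] using h (spaceM k)
  rw [ha, map_zero]

instance instFiniteDimensionalTangent (x : M) :
    FiniteDimensional ℝ (TangentSpace (𝓡 (m + 2)) x) :=
  inferInstanceAs (FiniteDimensional ℝ (EuclideanSpace ℝ (Fin (m + 2))))

instance instT2SpaceTangent (x : M) : T2Space (TangentSpace (𝓡 (m + 2)) x) :=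
  inferInstanceAs (T2Space (EuclideanSpace ℝ (Fin (m + 2))))

/-- Lowering an index: the isomorphism `v ↦ g(v, ·)` of `T_x M` onto its dual. -/
def LorentzianMetric.flat (g : LorentzianMetric m M) (x : M) :
    TangentSpace (𝓡 (m + 2)) x ≃ₗ[ℝ] (TangentSpace (𝓡 (m + 2)) x →ₗ[ℝ] ℝ) :=
  LinearEquiv.ofBijective
    ((ContinuousLinearMap.coeLM ℝ).comp (g.inner x).toLinearMap)
    (by
      have hinj : Function.Injective
          ((ContinuousLinearMap.coeLM ℝ).comp (g.inner x).toLinearMap :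
            TangentSpace (𝓡 (m + 2)) x →ₗ[ℝ] (TangentSpace (𝓡 (m + 2)) x →ₗ[ℝ] ℝ)) := by
        rw [injective_iff_map_eq_zero]
        intro v hv
        exact g.nondegenerate x fun w => LinearMap.congr_fun hv w
      exact ⟨hinj, (LinearMap.injective_iff_surjective_of_finrank_eq_finrank
        (Subspace.dual_finrank_eq (K := ℝ) (V := TangentSpace (𝓡 (m + 2)) x)).symm).1 hinj⟩)

theorem LorentzianMetric.flat_apply (g : LorentzianMetric m M) (x : M)
    (v w : TangentSpace (𝓡 (m + 2)) x) : g.flat x v w = g.inner x v w := rfl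

theorem LorentzianMetric.inner_flat_symm (g : LorentzianMetric m M) (x : M)
    (φ : TangentSpace (𝓡 (m + 2)) x →ₗ[ℝ] ℝ) (w : TangentSpace (𝓡 (m + 2)) x) :
    g.inner x ((g.flat x).symm φ) w = φ w := by
  rw [← g.flat_apply, LinearEquiv.apply_symm_apply]

open Classical in
/-- The Levi-Civita covariant derivative `v ↦ ∇_v Y` at `x`, given by the Koszul formula (and by
the value `0` where the vector field `Y` is not differentiable). -/
def leviCivitaFun (g : LorentzianMetric m M) (Y : ∀ x : M, TangentSpace (𝓡 (m + 2)) x) (x : M) :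
    TangentSpace (𝓡 (m + 2)) x →L[ℝ] TangentSpace (𝓡 (m + 2)) x :=
  if hY : DiffFieldAt Y x then
    LinearMap.toContinuousLinearMap ((g.flat x).symm.toLinearMap ∘ₗ
      (ContinuousLinearMap.coeLM ℝ) ∘ₗ ((2⁻¹ : ℝ) • koszulForm g hY).toLinearMap)
  else 0

theorem inner_leviCivitaFun (g : LorentzianMetric m M)
    {X Y Z : ∀ x : M, TangentSpace (𝓡 (m + 2)) x} {x : M}
    (hX : DiffFieldAt X x) (hY : DiffFieldAt Y x) (hZ : DiffFieldAt Z x) :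
    g.inner x (leviCivitaFun g Y x (X x)) (Z x) = 2⁻¹ * koszul g X Y Z x := by
  rw [leviCivitaFun, dif_pos hY, ← koszulForm_apply g hX hY hZ]
  exact g.inner_flat_symm x _ _

theorem exists_extension (x : M) (v : TangentSpace (𝓡 (m + 2)) x) :
    ∃ X : ∀ x : M, TangentSpace (𝓡 (m + 2)) x, DiffFieldAt X x ∧ X x = v :=
  ⟨FiberBundle.extend (EuclideanSpace ℝ (Fin (m + 2))) v,
    FiberBundle.mdifferentiableAt_extend .., by simp⟩

theorem LorentzianMetric.ext_inner (g : LorentzianMetric m M) (x : M)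
    {v w : TangentSpace (𝓡 (m + 2)) x}
    (h : ∀ Z : (∀ x : M, TangentSpace (𝓡 (m + 2)) x), DiffFieldAt Z x →
      g.inner x v (Z x) = g.inner x w (Z x)) : v = w := by
  rw [← sub_eq_zero]
  refine g.nondegenerate x fun z => ?_
  obtain ⟨Z, hZ, rfl⟩ := exists_extension x z
  rw [map_sub, _root_.sub_apply, h Z hZ, sub_self]

/-- The Levi-Civita connection of a Lorentzian metric. -/
def leviCivita (g : LorentzianMetric m M) :
    CovariantDerivative (𝓡 (m + 2)) (EuclideanSpace ℝ (Fin (m + 2)))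
      (TangentSpace (𝓡 (m + 2)) : M → Type _) where
  toFun := leviCivitaFun g
  isCovariantDerivativeOnUniv :=
    { add := by
        intro Y Y' x hY hY' _
        ext1 v
        obtain ⟨X, hX, rfl⟩ := exists_extension x v
        refine g.ext_inner x fun Z hZ => ?_
        have hYY : DiffFieldAt (Y + Y') x := mdifferentiableAt_add_section hY hY'
        rw [_root_.add_apply, map_add, _root_.add_apply,
          inner_leviCivitaFun g hX hYY hZ, inner_leviCivitaFun g hX hY hZ,
          inner_leviCivitaFun g hX hY' hZ, koszul_add_mid g hX hY hY' hZ, mul_add]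
      leibniz := by
        intro Y f x hY hf _
        ext1 v
        obtain ⟨X, hX, rfl⟩ := exists_extension x v
        refine g.ext_inner x fun Z hZ => ?_
        have hfY : DiffFieldAt (f • Y) x := hf.smul_section hY
        rw [inner_leviCivitaFun g hX hfY hZ, koszul_smul_mid g hf hX hY hZ,
          _root_.add_apply, map_add, _root_.add_apply, _root_.smul_apply, map_smul,
          _root_.smul_apply, inner_leviCivitaFun g hX hY hZ,
          ContinuousLinearMap.smulRight_apply, map_smul, _root_.smul_apply]
        simp only [smul_eq_mul]
        ring }

theorem inner_leviCivita (g : LorentzianMetric m M)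
    {X Y Z : ∀ x : M, TangentSpace (𝓡 (m + 2)) x} {x : M}
    (hX : DiffFieldAt X x) (hY : DiffFieldAt Y x) (hZ : DiffFieldAt Z x) :
    g.inner x (leviCivita g Y x (X x)) (Z x) = 2⁻¹ * koszul g X Y Z x :=
  inner_leviCivitaFun g hX hY hZ

theorem isLeviCivita_leviCivita (g : LorentzianMetric m M) : IsLeviCivita g (leviCivita g) where
  torsion_free X Y x hX hY := by
    refine g.ext_inner x fun Z hZ => ?_
    rw [map_sub, _root_.sub_apply, inner_leviCivita g hX hY hZ, inner_leviCivita g hY hX hZ]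
    have e : ∀ A B : ∀ x : M, TangentSpace (𝓡 (m + 2)) x,
        (fun y => g.inner y (A y) (B y)) = fun y => g.inner y (B y) (A y) := fun A B => by
      ext y; exact g.symm _ _ _
    simp only [koszul]
    rw [e X Z, e Z Y, e Y X, mlieBracket_swap_apply (V := Y) (W := X),
      mlieBracket_swap_apply (V := X) (W := Z), mlieBracket_swap_apply (V := Z) (W := Y)]
    simp only [map_neg, _root_.neg_apply]
    ring
  metric X Y Z x hY hZ := by
    obtain ⟨X', hX', hv⟩ := exists_extension x (X x)
    rw [← hv, g.symm x (Y x), inner_leviCivita g hX' hY hZ, inner_leviCivita g hX' hZ hY]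
    have e : ∀ A B : ∀ x : M, TangentSpace (𝓡 (m + 2)) x,
        (fun y => g.inner y (A y) (B y)) = fun y => g.inner y (B y) (A y) := fun A B => by
      ext y; exact g.symm _ _ _
    simp only [koszul]
    rw [e X' Z, e Z Y, e Y X', mlieBracket_swap_apply (V := X') (W := Y),
      mlieBracket_swap_apply (V := X') (W := Z), mlieBracket_swap_apply (V := Z) (W := Y)]
    simp only [map_neg, _root_.neg_apply]
    ring

/-! ## Kundt spacetimes -/

/-- The adjoint of an endomorphism `A` of `T_x M` with respect to `g`:
`g(A^† v, w) = g(v, A w)`. -/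
def LorentzianMetric.adjoint (g : LorentzianMetric m M) (x : M)
    (A : TangentSpace (𝓡 (m + 2)) x →ₗ[ℝ] TangentSpace (𝓡 (m + 2)) x) :
    TangentSpace (𝓡 (m + 2)) x →ₗ[ℝ] TangentSpace (𝓡 (m + 2)) x :=
  (g.flat x).symm.toLinearMap ∘ₗ A.lcomp ℝ ℝ ∘ₗ (g.flat x).toLinearMap

theorem LorentzianMetric.inner_adjoint (g : LorentzianMetric m M) (x : M)
    (A : TangentSpace (𝓡 (m + 2)) x →ₗ[ℝ] TangentSpace (𝓡 (m + 2)) x)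
    (v w : TangentSpace (𝓡 (m + 2)) x) :
    g.inner x (g.adjoint x A v) w = g.inner x v (A w) :=
  g.inner_flat_symm x _ _

/-- The divergence `∇_a X^a`. -/
def divergence (g : LorentzianMetric m M) (X : ∀ x : M, TangentSpace (𝓡 (m + 2)) x) (x : M) : ℝ :=
  LinearMap.trace ℝ (TangentSpace (𝓡 (m + 2)) x) (leviCivita g X x).toLinearMap

/-- The scalar `∇_{(a} X_{b)} ∇^a X^b`. With `A v = ∇_v X` one has `∇_a X_b = g(A e_a, e_b)`, so
`∇_{(a} X_{b)} = g(S e_a, e_b)` for the self-adjoint operator `S = (A + A^†) / 2`, and contracting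
`g(S e_a, e_b)` with `∇^a X^b` yields `tr (S ∘ A)`. -/
def shearScalar (g : LorentzianMetric m M) (X : ∀ x : M, TangentSpace (𝓡 (m + 2)) x) (x : M) : ℝ :=
  LinearMap.trace ℝ (TangentSpace (𝓡 (m + 2)) x)
    (((2⁻¹ : ℝ) • ((leviCivita g X x).toLinearMap + g.adjoint x (leviCivita g X x).toLinearMap)) ∘ₗ
      (leviCivita g X x).toLinearMap)

/-- `X` is a Kundt vector field of `(M, g, λ)` over `U`: a smooth nowhere vanishing vector field
in `λ` which is affinely geodesic, shear-free and divergence-free. -/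
structure IsKundtFieldOn (g : LorentzianMetric m M)
    (lam : ∀ x : M, Submodule ℝ (TangentSpace (𝓡 (m + 2)) x))
    (X : ∀ x : M, TangentSpace (𝓡 (m + 2)) x) (U : Set M) : Prop where
  smooth : SmoothFieldOn X U
  ne_zero : ∀ x ∈ U, X x ≠ 0
  mem : ∀ x ∈ U, X x ∈ lam x
  geodesic : ∀ x ∈ U, leviCivita g X x (X x) = 0
  shear_free : ∀ x ∈ U, shearScalar g X x = 0
  divergence_free : ∀ x ∈ U, divergence g X x = 0

/-- `(M, g, λ)` is a Kundt spacetime: `λ` is a null distribution, `λ^⊥` is integrable, and about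
each point there is a local Kundt vector field. -/
structure IsKundtSpacetime (g : LorentzianMetric m M)
    (lam : ∀ x : M, Submodule ℝ (TangentSpace (𝓡 (m + 2)) x)) : Prop where
  isNull : IsNullDistribution g lam
  integrable : IsIntegrableDistribution (perpDistribution g lam)
  exists_kundtField : ∀ p : M, ∃ U : Set M, IsOpen U ∧ p ∈ U ∧
    ∃ X : ∀ x : M, TangentSpace (𝓡 (m + 2)) x, IsKundtFieldOn g lam X U

end Manifold

end

/-! Let `A v = ∇_v X` for a Kundt field `X`. Since `X` is null, `A` takes values in `X^⊥`, and the
geodesic equation says `A X = 0`. Hence `L_X g (v, w) = g(A v, w) + g(v, A w)` vanishes as soon as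
one argument is `X`. On `X^⊥/X`, where `g` is positive definite, `A` induces a matrix `a`, and the
shear scalar is `¼ ∑ (a i j + a j i)²`; its vanishing makes `a` skew, so `L_X g` also vanishes on
`X^⊥ × X^⊥` (`symm_part_eq_zero`). These two blocks of `g` are exactly what `P(M, g, λ)` remembers:
its frames send `k` into `λ` and match `η` with `g` on `k^⊥ × k^⊥` and on `k × ℝⁿ`
(`mem_inducedGNStructure_iff_forall`).

To pass to the flow `φ_t`, note that `X` and the push-forwards `Dφ_t v` are Lie transported along
integral curves, and that the derivative of the product of two Lie transported fields is `L_X g` of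
them (`IsLieTransportedAt.hasDerivAt_inner`). So `g(X, Dφ_t w)` is constant; hence `Dφ_t` preserves
`X^⊥`, and `g(Dφ_t v, Dφ_t w)` is constant for `v, w` in `X^⊥`. It follows that `Dφ_t X = X`, and
frames of `P` go to frames of `P`.

The `GN`-action on the fibres of `P` is read off from the same two blocks, and smooth local sections
come from Gram–Schmidt. The associated distributions are `λ` and `λ^⊥`, so integrability is
inherited. -/

set_option linter.unusedSectionVars false

noncomputable section

variable {m : ℕ} {M : Type*} [TopologicalSpace M]
  [ChartedSpace (EuclideanSpace ℝ (Fin (m + 2))) M] [IsManifold (𝓡 (m + 2)) ∞ M]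

/-! ### Linear algebra of adapted null frames. -/

/-- The vectors `X, Y, Zᵢ` of `T_x M` form a null frame adapted to the line spanned by the null
vector `X`; the products of `Y` with itself and with the `Zᵢ` are not constrained. -/
structure LorentzianMetric.IsAdapted (g : LorentzianMetric m M) {x : M}
    (X Y : TangentSpace (𝓡 (m + 2)) x) (Z : Fin m → TangentSpace (𝓡 (m + 2)) x) : Prop where
  null : g.inner x X X = 0
  pairing : g.inner x X Y = 1
  perp : ∀ i, g.inner x X (Z i) = 0
  orthonormal : ∀ i j, g.inner x (Z i) (Z j) = if i = j then 1 else 0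

section Frame

variable {g : LorentzianMetric m M} {x : M} {X Y : TangentSpace (𝓡 (m + 2)) x}
  {Z : Fin m → TangentSpace (𝓡 (m + 2)) x}

/-- The linear map `ℝⁿ → T_x M` sending the standard basis to `X, Y, Z₁, …, Z_m`. -/
def frameMap (X Y : TangentSpace (𝓡 (m + 2)) x) (Z : Fin m → TangentSpace (𝓡 (m + 2)) x) :
    (Fin (m + 2) → ℝ) →ₗ[ℝ] TangentSpace (𝓡 (m + 2)) x where
  toFun w := w 0 • X + w 1 • Y + ∑ i : Fin m, w i.succ.succ • Z i
  map_add' v w := by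
    simp only [Pi.add_apply, add_smul, Finset.sum_add_distrib]
    abel
  map_smul' c v := by
    simp only [Pi.smul_apply, smul_eq_mul, mul_smul, Finset.smul_sum, smul_add, RingHom.id_apply]

theorem frameMap_apply (w : Fin (m + 2) → ℝ) :
    frameMap X Y Z w = w 0 • X + w 1 • Y + ∑ i : Fin m, w i.succ.succ • Z i := rfl

theorem frameMap_nullK : frameMap X Y Z (nullK m) = X := by
  simp [frameMap_apply, nullK]

theorem frameMap_nullL : frameMap X Y Z (nullL m) = Y := by
  simp [frameMap_apply, nullL, Fin.ext_iff]

theorem frameMap_spaceM (i : Fin m) : frameMap X Y Z (spaceM i) = Z i := by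
  have h1 : (1 : Fin (m + 2)) ≠ i.succ.succ := by simp [Fin.ext_iff]
  have h0 : (0 : Fin (m + 2)) ≠ i.succ.succ := by simp [Fin.ext_iff]
  simp [frameMap_apply, spaceM, Pi.single_apply, h0, h1]

/-- Lets an arbitrary frame be handled through the images of the standard basis vectors. -/
theorem frameMap_linearEquiv (u : (Fin (m + 2) → ℝ) ≃ₗ[ℝ] TangentSpace (𝓡 (m + 2)) x) :
    frameMap (u (nullK m)) (u (nullL m)) (fun i => u (spaceM i)) = u.toLinearMap := by
  refine (Pi.basisFun ℝ (Fin (m + 2))).ext fun i => ?_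
  rw [Pi.basisFun_apply]
  refine Fin.cases ?_ (fun j => Fin.cases ?_ (fun k => ?_) j) i
  · exact frameMap_nullK
  · exact frameMap_nullL
  · exact frameMap_spaceM k

namespace LorentzianMetric.IsAdapted

theorem inner_left_frameMap (h : g.IsAdapted X Y Z) (w : Fin (m + 2) → ℝ) :
    g.inner x X (frameMap X Y Z w) = w 1 := by
  simp [frameMap_apply, h.null, h.pairing, h.perp]

/-- The products `g(Zᵢ, Y)` are arbitrary, so the coefficient of `Y` has to vanish here. -/
theorem inner_space_frameMap (h : g.IsAdapted X Y Z) (w : Fin (m + 2) → ℝ) (hw : w 1 = 0)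
    (i : Fin m) : g.inner x (Z i) (frameMap X Y Z w) = w i.succ.succ := by
  simp [frameMap_apply, g.symm x (Z i) X, h.perp, h.orthonormal, hw]

/-- Products with `X` detect the coefficient of `Y`; once that is zero, products with the `Zᵢ`
detect theirs, and a multiple of `X ≠ 0` remains. -/
theorem injective_frameMap (h : g.IsAdapted X Y Z) : Function.Injective (frameMap X Y Z) := by
  rw [injective_iff_map_eq_zero]
  intro w hw
  have h1 : w 1 = 0 := by rw [← h.inner_left_frameMap w, hw, map_zero]
  have h2 : ∀ i : Fin m, w i.succ.succ = 0 := fun i => by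
    rw [← h.inner_space_frameMap w h1 i, hw, map_zero]
  have h0 : w 0 • X = 0 := by simpa [frameMap_apply, h1, h2] using hw
  have hX : X ≠ 0 := fun h0 => by simpa [h0] using h.pairing
  have h0' : w 0 = 0 := (smul_eq_zero.1 h0).resolve_right hX
  ext i
  exact Fin.cases h0' (fun j => Fin.cases h1 h2 j) i

/-- The frame given by an adapted tuple. -/
def frameEquiv (h : g.IsAdapted X Y Z) :
    (Fin (m + 2) → ℝ) ≃ₗ[ℝ] TangentSpace (𝓡 (m + 2)) x :=
  LinearEquiv.ofInjectiveOfFinrankEq (frameMap X Y Z) h.injective_frameMap (by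
    rw [Module.finrank_fin_fun]
    exact (finrank_euclideanSpace_fin (𝕜 := ℝ) (n := m + 2)).symm)

theorem frameEquiv_apply (h : g.IsAdapted X Y Z) (w : Fin (m + 2) → ℝ) :
    h.frameEquiv w = frameMap X Y Z w := rfl

theorem ne_zero (h : g.IsAdapted X Y Z) : X ≠ 0 := fun h0 => by simpa [h0] using h.pairing

/-- An adapted frame intertwines `η` and `g` as far as the conditions on `GN` prescribe. -/
theorem inner_frameMap (h : g.IsAdapted X Y Z) {w w' : Fin (m + 2) → ℝ} (hw : w ∈ perpK m)
    (hw' : w' ∈ perpK m) :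
    g.inner x (frameMap X Y Z w) (frameMap X Y Z w') = minkowski w w' := by
  have h1 : w 1 = 0 := (minkowski_nullK_left w).symm.trans hw
  have h1' : w' 1 = 0 := (minkowski_nullK_left w').symm.trans hw'
  rw [frameMap_apply (w := w)]
  simp [h.inner_left_frameMap, h.inner_space_frameMap w' h1', h1, h1', minkowski]

/-- A vector orthogonal to `X` and to all the `Zᵢ` is a multiple of `X`. -/
theorem exists_smul_eq (h : g.IsAdapted X Y Z) {v : TangentSpace (𝓡 (m + 2)) x}
    (hX : g.inner x X v = 0) (hZ : ∀ i, g.inner x (Z i) v = 0) : ∃ a : ℝ, v = a • X := by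
  obtain ⟨w, rfl⟩ := h.frameEquiv.surjective v
  rw [frameEquiv_apply] at *
  have h1 : w 1 = 0 := by rw [← h.inner_left_frameMap w, hX]
  have h2 : ∀ i : Fin m, w i.succ.succ = 0 := fun i => by
    rw [← h.inner_space_frameMap w h1 i]; exact hZ i
  exact ⟨w 0, by simp [frameMap_apply, h1, h2]⟩

end LorentzianMetric.IsAdapted

/-- A nonzero null vector can be completed to an adapted frame. -/
theorem LorentzianMetric.exists_isAdapted (g : LorentzianMetric m M)
    {X : TangentSpace (𝓡 (m + 2)) x} (h0 : X ≠ 0) (hnull : g.inner x X X = 0) :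
    ∃ Y Z, g.IsAdapted X Y Z := by
  obtain ⟨u, hu⟩ := g.signature x
  obtain ⟨v, rfl⟩ := u.surjective X
  have hv : minkowski v v = 0 := by rw [← hu, hnull]
  have hne : ∀ i j : Fin m, i.succ.succ = j.succ.succ ↔ i = j := fun i j => by simp [Fin.ext_iff]
  have hone : ∀ i : Fin m, (1 : Fin (m + 2)) ≠ i.succ.succ := fun i => by simp [Fin.ext_iff]
  suffices H : ∃ (Y : Fin (m + 2) → ℝ) (Z : Fin m → Fin (m + 2) → ℝ), minkowski v Y = 1 ∧
      (∀ i : Fin m, minkowski v (Z i) = 0) ∧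
      ∀ i j, minkowski (Z i) (Z j) = if i = j then 1 else 0 by
    obtain ⟨Y, Z, h1, h2, h3⟩ := H
    exact ⟨u Y, fun i => u (Z i), hnull, by rw [hu, h1], fun i => by rw [hu, h2],
      fun i j => by rw [hu, h3]⟩
  -- The component `v 1` is `η(k, v)`. If it vanishes, nullity of `v` kills the spacelike components
  -- and `v` is a multiple of `k`; otherwise `k` itself, rescaled, serves as `Y`.
  by_cases h1 : v 1 = 0
  · have hsum : ∑ i : Fin m, v i.succ.succ * v i.succ.succ = 0 := by
      simpa [minkowski, h1] using hv
    have hz : ∀ i : Fin m, v i.succ.succ = 0 := fun i => by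
      simpa using (Finset.sum_eq_zero_iff_of_nonneg
        (fun i _ => mul_self_nonneg (v i.succ.succ))).1 hsum i (Finset.mem_univ i)
    have hv0 : v 0 ≠ 0 := by
      intro hv0
      apply h0
      have : v = 0 := by
        ext i
        exact Fin.cases hv0 (fun j => Fin.cases h1 hz j) i
      rw [this, map_zero]
    refine ⟨(v 0)⁻¹ • nullL m, spaceM, ?_, fun i => ?_, fun i j => ?_⟩
    · simp [minkowski, h1, hz, hv0, nullL]
    · simp [minkowski, h1, hz, spaceM, Pi.single_apply, hone]
    · rw [minkowski_single_succ_succ, spaceM, Pi.single_apply]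
      simp [hne]
  -- Subtracting a multiple of `k` makes `mᵢ` orthogonal to `v` and leaves the products of the `mᵢ`
  -- unchanged, because `k` is null and orthogonal to them.
  · refine ⟨(v 1)⁻¹ • nullK m, fun i => spaceM i - (v i.succ.succ / v 1) • nullK m, ?_,
      fun i => ?_, fun i j => ?_⟩
    · simp [minkowski, h1, nullK]
    · simp [minkowski, spaceM, nullK, Pi.single_apply, hone]
      field_simp
      ring
    · simp [minkowski, spaceM, nullK, Pi.single_apply, hone, hne, eq_comm]

end Frame

/-! ### The fibres of `P(M, g, λ)` and its associated distributions. -/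

section InducedStructure

variable {g : LorentzianMetric m M}
  {lam : ∀ x : M, Submodule ℝ (TangentSpace (𝓡 (m + 2)) x)} {x : M}

theorem IsSmoothDistribution.exists_span_singleton (h : IsSmoothDistribution 1 lam) (x : M) :
    ∃ X, X ≠ 0 ∧ lam x = Submodule.span ℝ {X} := by
  obtain ⟨U, -, hx, X, -, hX⟩ := h x
  obtain ⟨hl, hs⟩ := hX x hx
  refine ⟨X 0 x, hl.ne_zero 0, ?_⟩
  rw [← hs]
  congr 1
  exact Set.range_unique

theorem IsSmoothDistribution.eq_span_singleton (h : IsSmoothDistribution 1 lam)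
    {X : TangentSpace (𝓡 (m + 2)) x} (hX : X ∈ lam x) (h0 : X ≠ 0) :
    lam x = Submodule.span ℝ {X} := by
  obtain ⟨X₀, -, hs⟩ := h.exists_span_singleton x
  rw [hs] at hX ⊢
  obtain ⟨c, rfl⟩ := Submodule.mem_span_singleton.1 hX
  have hc : c ≠ 0 := by
    rintro rfl
    simp at h0
  exact (Submodule.span_singleton_smul_eq (IsUnit.mk0 c hc) X₀).symm

theorem mem_perpDistribution_iff {X v : TangentSpace (𝓡 (m + 2)) x}
    (hX : lam x = Submodule.span ℝ {X}) :
    v ∈ perpDistribution g lam x ↔ g.inner x X v = 0 := by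
  refine ⟨fun h => h X (hX ▸ Submodule.mem_span_singleton_self X), fun h w hw => ?_⟩
  rw [hX] at hw
  obtain ⟨c, rfl⟩ := Submodule.mem_span_singleton.1 hw
  simp [h]

/-- The forms on the quotients evaluate on classes to `g` by definition, and orthogonality to the
first vector is orthogonality to `λ`, the line it spans. -/
theorem mem_inducedGNStructure_iff (h : IsNullDistribution g lam)
    {u : (Fin (m + 2) → ℝ) ≃ₗ[ℝ] TangentSpace (𝓡 (m + 2)) x} :
    u ∈ inducedGNStructure g lam x ↔ u (nullK m) ∈ lam x ∧
      g.IsAdapted (u (nullK m)) (u (nullL m)) fun i => u (spaceM i) := by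
  constructor
  · rintro ⟨⟨hX, h1⟩, hZ, h2⟩
    exact ⟨hX, h.null x _ hX, h1, fun i => hZ i _ hX, fun i j => h2 i j⟩
  · rintro ⟨hX, ha⟩
    have hk : u (nullK m) ≠ 0 := ha.ne_zero
    have hs := h.smooth.eq_span_singleton hX hk
    exact ⟨⟨hX, ha.pairing⟩, fun i => (mem_perpDistribution_iff hs).2 (ha.perp i),
      fun i j => ha.orthonormal i j⟩

theorem LorentzianMetric.IsAdapted.frameEquiv_mem (h : IsNullDistribution g lam)
    {X Y : TangentSpace (𝓡 (m + 2)) x} {Z : Fin m → TangentSpace (𝓡 (m + 2)) x}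
    (ha : g.IsAdapted X Y Z) (hX : X ∈ lam x) : ha.frameEquiv ∈ inducedGNStructure g lam x := by
  rw [mem_inducedGNStructure_iff h]
  simp only [frameEquiv_apply, frameMap_nullK, frameMap_nullL, frameMap_spaceM]
  exact ⟨hX, ha⟩

theorem spaceM_mem_perpK (i : Fin m) : spaceM i ∈ perpK m := by
  change minkowski _ _ = 0
  simp [minkowski_nullK_left, spaceM, Fin.ext_iff]

/-- Membership in `P(M, g, λ)` without reference to the standard basis beyond `k`. -/
theorem mem_inducedGNStructure_iff_forall (h : IsNullDistribution g lam)
    {u : (Fin (m + 2) → ℝ) ≃ₗ[ℝ] TangentSpace (𝓡 (m + 2)) x} :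
    u ∈ inducedGNStructure g lam x ↔ u (nullK m) ∈ lam x ∧
      (∀ w ∈ perpK m, ∀ w' ∈ perpK m, g.inner x (u w) (u w') = minkowski w w') ∧
      ∀ z, g.inner x (u (nullK m)) (u z) = minkowski (nullK m) z := by
  rw [mem_inducedGNStructure_iff h]
  refine and_congr_right fun hX => ⟨fun ha => ?_, fun ⟨hp, hk⟩ => ⟨h.null x _ hX, ?_, ?_, ?_⟩⟩
  · have hu : ∀ w, u w =
        frameMap (u (nullK m)) (u (nullL m)) (fun i => u (spaceM i)) w := fun w => by
      rw [frameMap_linearEquiv]; rfl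
    refine ⟨fun w hw w' hw' => ?_, fun z => ?_⟩
    · rw [hu w, hu w', ha.inner_frameMap hw hw']
    · rw [hu z, ha.inner_left_frameMap, minkowski_nullK_left]
  · rw [hk, minkowski_nullK_left]
    simp [nullL]
  · intro i
    rw [hk]
    exact spaceM_mem_perpK i
  · intro i j
    rw [hp _ (spaceM_mem_perpK i) _ (spaceM_mem_perpK j), minkowski_single_succ_succ, spaceM,
      Pi.single_apply]
    simp [Fin.ext_iff]

theorem inducedGNStructure_right_invariant (h : IsNullDistribution g lam)
    {u : (Fin (m + 2) → ℝ) ≃ₗ[ℝ] TangentSpace (𝓡 (m + 2)) x}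
    (hu : u ∈ inducedGNStructure g lam x)
    {a : (Fin (m + 2) → ℝ) ≃ₗ[ℝ] (Fin (m + 2) → ℝ)} (ha : a ∈ GN m) :
    a.trans u ∈ inducedGNStructure g lam x := by
  rw [mem_inducedGNStructure_iff_forall h] at hu ⊢
  obtain ⟨hX, hp, hk⟩ := hu
  change IsGN a at ha
  obtain ⟨c, hc, hac⟩ := ha.exists_scale
  refine ⟨?_, fun w hw w' hw' => ?_, fun z => ?_⟩
  · rw [LinearEquiv.trans_apply, hac, map_smul]
    exact Submodule.smul_mem _ _ hX
  · rw [LinearEquiv.trans_apply, LinearEquiv.trans_apply,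
      hp _ (ha.mem_perp.2 hw) _ (ha.mem_perp.2 hw'), ha.perp _ hw _ hw']
  · rw [LinearEquiv.trans_apply, LinearEquiv.trans_apply, ← ha.pairing z, hac, map_smul,
      minkowski_smul_left, ← hk, map_smul, _root_.smul_apply, smul_eq_mul]

/-- The group element is `u⁻¹ u'`. It scales `k` by some `c ≠ 0`, as both frames send `k` into the
same line; the pairing condition then shows that it preserves `k^⊥`, where the two isometry
conditions can be compared. -/
theorem inducedGNStructure_transitive (h : IsNullDistribution g lam)
    {u u' : (Fin (m + 2) → ℝ) ≃ₗ[ℝ] TangentSpace (𝓡 (m + 2)) x}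
    (hu : u ∈ inducedGNStructure g lam x) (hu' : u' ∈ inducedGNStructure g lam x) :
    ∃ a ∈ GN m, u' = a.trans u := by
  rw [mem_inducedGNStructure_iff_forall h] at hu hu'
  obtain ⟨hX, hp, hk⟩ := hu
  obtain ⟨hX', hp', hk'⟩ := hu'
  have hne : u (nullK m) ≠ 0 := fun h0 => by
    have := hk (nullL m)
    rw [h0, minkowski_nullK_left] at this
    simp [nullL] at this
  rw [h.smooth.eq_span_singleton hX hne] at hX'
  obtain ⟨c, hc⟩ := Submodule.mem_span_singleton.1 hX'
  have hcomp : ∀ z, u ((u'.trans u.symm) z) = u' z := fun z => by simp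
  have hak : (u'.trans u.symm) (nullK m) = c • nullK m := by
    apply u.injective
    rw [hcomp, map_smul, hc]
  have hpair : ∀ z, minkowski ((u'.trans u.symm) (nullK m)) ((u'.trans u.symm) z) =
      minkowski (nullK m) z := fun z => by
    rw [hak, minkowski_smul_left, ← hk, hcomp, ← hk', ← hc, map_smul, _root_.smul_apply,
      smul_eq_mul]
  have hc0 : c ≠ 0 := by
    rintro rfl
    rw [zero_smul] at hc
    exact u'.map_ne_zero_iff.2 (fun h0 => hne (by rw [h0, map_zero])) hc.symm
  have hperp : ∀ z ∈ perpK m, (u'.trans u.symm) z ∈ perpK m := fun z hz => by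
    have := hpair z
    rw [hak, minkowski_smul_left] at this
    have hz' : minkowski (nullK m) z = 0 := hz
    rw [hz', mul_eq_zero, or_iff_right hc0] at this
    exact this
  refine ⟨u'.trans u.symm, ⟨?_, fun w hw w' hw' => ?_, hpair⟩, ?_⟩
  · rw [hak]
    exact Submodule.smul_mem _ _ (Submodule.mem_span_singleton_self _)
  · rw [← hp _ (hperp w hw) _ (hperp w' hw'), hcomp, hcomp, hp' _ hw _ hw']
  · ext z
    simp

theorem inducedGNStructure_nonempty (h : IsNullDistribution g lam) (x : M) :
    (inducedGNStructure g lam x).Nonempty := by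
  obtain ⟨X, h0, hs⟩ := h.smooth.exists_span_singleton x
  have hX : X ∈ lam x := hs ▸ Submodule.mem_span_singleton_self X
  obtain ⟨Y, Z, ha⟩ := g.exists_isAdapted h0 (h.null x X hX)
  exact ⟨_, ha.frameEquiv_mem h hX⟩

/-- Every frame of a fibre gives the same line; nonemptiness of the fibre keeps the supremum from
being `⊥`. -/
theorem assocLine_inducedGNStructure (h : IsNullDistribution g lam) :
    assocLine (inducedGNStructure g lam) = lam := by
  ext1 x
  have key : ∀ u ∈ inducedGNStructure g lam x, (lineK m).map u.toLinearMap = lam x := by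
    intro u hu
    obtain ⟨hX, ha⟩ := (mem_inducedGNStructure_iff h).1 hu
    rw [h.smooth.eq_span_singleton hX ha.ne_zero, lineK, Submodule.map_span, Set.image_singleton]
    rfl
  obtain ⟨u, hu⟩ := inducedGNStructure_nonempty h x
  exact le_antisymm (iSup₂_le fun u hu => (key u hu).le)
    ((key u hu).ge.trans (le_iSup₂_of_le u hu le_rfl))

theorem assocHyperplane_inducedGNStructure (h : IsNullDistribution g lam) :
    assocHyperplane (inducedGNStructure g lam) = perpDistribution g lam := by
  ext1 x
  have key : ∀ u ∈ inducedGNStructure g lam x,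
      (perpK m).map u.toLinearMap = perpDistribution g lam x := by
    intro u hu
    have ha := ((mem_inducedGNStructure_iff h).1 hu).2
    obtain ⟨hX, -, hk⟩ := (mem_inducedGNStructure_iff_forall h).1 hu
    have hs := h.smooth.eq_span_singleton hX ha.ne_zero
    ext v
    obtain ⟨w, rfl⟩ := u.surjective v
    rw [mem_perpDistribution_iff hs, hk]
    constructor
    · rintro ⟨w', hw', he⟩
      have : w' = w := u.injective he
      exact this ▸ hw'
    · exact fun hw => ⟨w, hw, rfl⟩
  obtain ⟨u, hu⟩ := inducedGNStructure_nonempty h x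
  exact le_antisymm (iSup₂_le fun u hu => (key u hu).le)
    ((key u hu).ge.trans (le_iSup₂_of_le u hu le_rfl))

end InducedStructure

/-! ### The equation of variation in normed spaces. -/

section Calculus

variable {E F G : Type*} [NormedAddCommGroup E] [NormedSpace ℝ E]
  [NormedAddCommGroup F] [NormedSpace ℝ F] [NormedAddCommGroup G] [NormedSpace ℝ G]

/-- On a finite-dimensional space, a curve of continuous linear maps may be differentiated
pointwise. -/
theorem hasDerivAt_clm_of_forall_apply [FiniteDimensional ℝ E] {A : ℝ → E →L[ℝ] F}
    {A' : E →L[ℝ] F} {t₀ : ℝ} (h : ∀ v, HasDerivAt (fun t => A t v) (A' v) t₀) :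
    HasDerivAt A A' t₀ := by
  have hd : Module.finrank ℝ E = Module.finrank ℝ (Fin (Module.finrank ℝ E) → ℝ) :=
    (Module.finrank_fin_fun ℝ).symm
  -- In a basis of `E` a linear map becomes the tuple of its values, and tuples are differentiated
  -- componentwise.
  let e₁ := ContinuousLinearEquiv.ofFinrankEq hd
  let e₂ := (e₁.arrowCongr (1 : F ≃L[ℝ] F)).trans
    (ContinuousLinearEquiv.piRing (Fin (Module.finrank ℝ E)))
  have he : HasDerivAt (fun t => e₂ (A t)) (e₂ A') t₀ := hasDerivAt_pi.2 fun i => h _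
  simpa [Function.comp_def] using
    e₂.symm.toContinuousLinearMap.hasFDerivAt.comp_hasDerivAt t₀ he

/-- The equation of variation: if `t ↦ Φ(t, z)` are integral curves of `X`, then the derivatives
of `Φ` with respect to `z` satisfy the linearised equation. -/
theorem hasDerivAt_fderiv_flow_apply {Φ : ℝ × E → F} {X : F → F} {t₀ : ℝ} {z₀ : E}
    (hΦ : ContDiffAt ℝ 2 Φ (t₀, z₀)) (hX : DifferentiableAt ℝ X (Φ (t₀, z₀)))
    (h : ∀ᶠ q in 𝓝 (t₀, z₀), HasDerivAt (fun t => Φ (t, q.2)) (X (Φ q)) q.1) (w : E) :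
    HasDerivAt (fun t => fderiv ℝ (fun z => Φ (t, z)) z₀ w)
      (fderiv ℝ X (Φ (t₀, z₀)) (fderiv ℝ (fun z => Φ (t₀, z)) z₀ w)) t₀ := by
  have hd : ∀ᶠ q in 𝓝 (t₀, z₀), DifferentiableAt ℝ Φ q :=
    (hΦ.eventually (by simp)).mono fun q hq => hq.differentiableAt (by simp)
  have hΦ' : DifferentiableAt ℝ (fderiv ℝ Φ) (t₀, z₀) :=
    (hΦ.fderiv_right (m := 1) (by norm_num)).differentiableAt (by simp)
  have hpart : ∀ q : ℝ × E, DifferentiableAt ℝ Φ q →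
      fderiv ℝ (fun z => Φ (q.1, z)) q.2 w = fderiv ℝ Φ q (0, w) := fun q hq => by
    have h1 : HasFDerivAt (fun z => Φ (q.1, z))
        ((fderiv ℝ Φ q).comp (ContinuousLinearMap.inr ℝ ℝ E)) q.2 :=
      hq.hasFDerivAt.comp q.2 (hasFDerivAt_prodMk_right q.1 q.2)
    rw [h1.fderiv]
    simp
  have htime : ∀ᶠ q in 𝓝 (t₀, z₀), fderiv ℝ Φ q (1, 0) = X (Φ q) := by
    filter_upwards [hd, h] with q hq hq'
    have h1 : HasDerivAt (fun t => Φ (t, q.2)) (fderiv ℝ Φ q (1, 0)) q.1 := by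
      simpa [Function.comp_def] using
        (hq.hasFDerivAt.comp q.1 (hasFDerivAt_prodMk_left q.1 q.2)).hasDerivAt
    exact h1.unique hq'
  have hline : Filter.Tendsto (fun t : ℝ => (t, z₀)) (𝓝 t₀) (𝓝 (t₀, z₀)) := by
    exact (Continuous.prodMk_left z₀).tendsto t₀
  have hev : (fun t => fderiv ℝ (fun z => Φ (t, z)) z₀ w) =ᶠ[𝓝 t₀]
      fun t => fderiv ℝ Φ (t, z₀) (0, w) :=
    (hline.eventually hd).mono fun t ht => hpart (t, z₀) ht
  have h2 : HasDerivAt (fun t => fderiv ℝ Φ (t, z₀))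
      (fderiv ℝ (fderiv ℝ Φ) (t₀, z₀) (1, 0)) t₀ := by
    simpa [Function.comp_def] using
      (hΦ'.hasFDerivAt.comp t₀ (hasFDerivAt_prodMk_left t₀ z₀)).hasDerivAt
  -- This differentiates the flow equation `∂_t Φ = X ∘ Φ` in the direction `(0, w)`.
  have h3 : fderiv ℝ (fderiv ℝ Φ) (t₀, z₀) (0, w) (1, 0) =
      fderiv ℝ X (Φ (t₀, z₀)) (fderiv ℝ Φ (t₀, z₀) (0, w)) := by
    have ha : HasFDerivAt (fun q => fderiv ℝ Φ q (1, 0))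
        ((fderiv ℝ (fderiv ℝ Φ) (t₀, z₀)).flip (1, 0)) (t₀, z₀) := by
      simpa using hΦ'.hasFDerivAt.clm_apply (hasFDerivAt_const ((1 : ℝ), (0 : E)) (t₀, z₀))
    have hb : HasFDerivAt (fun q => X (Φ q))
        ((fderiv ℝ X (Φ (t₀, z₀))).comp (fderiv ℝ Φ (t₀, z₀))) (t₀, z₀) :=
      hX.hasFDerivAt.comp _ hd.self_of_nhds.hasFDerivAt
    have := ha.unique (hb.congr_of_eventuallyEq htime)
    exact DFunLike.congr_fun this (0, w)
  -- Symmetry of the second derivative exchanges the time and space derivatives; this is where `C²`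
  -- is needed.
  have h4 := (hΦ.isSymmSndFDerivAt (by simp)) (1, 0) (0, w)
  rw [hpart (t₀, z₀) hd.self_of_nhds, ← h3, ← h4]
  refine HasDerivAt.congr_of_eventuallyEq ?_ hev
  simpa using h2.clm_apply (hasDerivAt_const t₀ ((0 : ℝ), w))

end Calculus

/-! ### Vector fields read in a chart. -/

section ChartField

variable {X : ∀ x : M, TangentSpace (𝓡 (m + 2)) x} {q x : M}

/-- The vector field `X` read in the chart at `q`. -/
def chartField (X : ∀ x : M, TangentSpace (𝓡 (m + 2)) x) (q : M) :
    EuclideanSpace ℝ (Fin (m + 2)) → EuclideanSpace ℝ (Fin (m + 2)) :=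
  mpullbackWithin 𝓘(ℝ, EuclideanSpace ℝ (Fin (m + 2))) (𝓡 (m + 2)) (extChartAt (𝓡 (m + 2)) q).symm X
    (range (𝓡 (m + 2)))

theorem chartField_extChartAt (hx : x ∈ (extChartAt (𝓡 (m + 2)) q).source) :
    chartField X q (extChartAt (𝓡 (m + 2)) q x) =
      mfderiv (𝓡 (m + 2)) 𝓘(ℝ, EuclideanSpace ℝ (Fin (m + 2))) (extChartAt (𝓡 (m + 2)) q) x
        (X x) := by
  have h1 := mfderiv_extChartAt_comp_mfderivWithin_extChartAt_symm' (I := 𝓡 (m + 2)) hx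
  have h2 := mfderivWithin_extChartAt_symm_comp_mfderiv_extChartAt' (I := 𝓡 (m + 2)) hx
  rw [chartField, mpullbackWithin_apply, (extChartAt (𝓡 (m + 2)) q).left_inv hx]
  exact congrArg (fun A => A (X x)) (ContinuousLinearMap.inverse_eq h2 h1)

theorem differentiableAt_chartField (hX : DiffFieldAt X q) :
    DifferentiableAt ℝ (chartField X q) (extChartAt (𝓡 (m + 2)) q q) := by
  have := MDifferentiableWithinAt.differentiableWithinAt_mpullbackWithin_vectorField
    (mdifferentiableWithinAt_univ.2 hX)
  rw [preimage_univ, univ_inter, ModelWithCorners.range_eq_univ] at this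
  rw [chartField, ModelWithCorners.range_eq_univ]
  exact differentiableWithinAt_univ.1 this

/-- `T_q M` is identified with the model space through the preferred chart at `q`, so tangent
vectors at the base point are their own coordinate vectors. -/
theorem mfderiv_extChartAt_self_apply (v : TangentSpace (𝓡 (m + 2)) q) :
    mfderiv (𝓡 (m + 2)) 𝓘(ℝ, EuclideanSpace ℝ (Fin (m + 2))) (extChartAt (𝓡 (m + 2)) q) q v =
      v := by
  rw [mfderiv_extChartAt_self]
  rfl

theorem symmL_mfderiv_extChartAt (v : TangentSpace (𝓡 (m + 2)) x)
    (hx : x ∈ (extChartAt (𝓡 (m + 2)) q).source) :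
    (trivializationAt (EuclideanSpace ℝ (Fin (m + 2))) (TangentSpace (𝓡 (m + 2))) q).symmL ℝ x
      (mfderiv (𝓡 (m + 2)) 𝓘(ℝ, EuclideanSpace ℝ (Fin (m + 2))) (extChartAt (𝓡 (m + 2)) q) x v) =
      v := by
  rw [extChartAt_source] at hx
  rw [← TangentBundle.continuousLinearMapAt_trivializationAt hx]
  exact Trivialization.symmL_continuousLinearMapAt _ (by simpa using hx) v

/-- The derivative of `X` at `q` in the chart at `q`, an endomorphism of `T_q M`. -/
def chartFieldDeriv (X : ∀ x : M, TangentSpace (𝓡 (m + 2)) x) (q : M) :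
    TangentSpace (𝓡 (m + 2)) q →L[ℝ] TangentSpace (𝓡 (m + 2)) q :=
  (fderiv ℝ (chartField X q) (extChartAt (𝓡 (m + 2)) q q) :
    EuclideanSpace ℝ (Fin (m + 2)) →L[ℝ] EuclideanSpace ℝ (Fin (m + 2)))

/-- The vector field near `q` with constant components `v` in the chart at `q`. -/
def constField (v : TangentSpace (𝓡 (m + 2)) q) (x : M) :
    TangentSpace (𝓡 (m + 2)) x :=
  (trivializationAt (EuclideanSpace ℝ (Fin (m + 2))) (TangentSpace (𝓡 (m + 2))) q).symmL ℝ x v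

variable {v : TangentSpace (𝓡 (m + 2)) q}

theorem mfderiv_extChartAt_constField (hx : x ∈ (extChartAt (𝓡 (m + 2)) q).source) :
    mfderiv (𝓡 (m + 2)) 𝓘(ℝ, EuclideanSpace ℝ (Fin (m + 2))) (extChartAt (𝓡 (m + 2)) q) x
      (constField v x) = v := by
  rw [extChartAt_source] at hx
  rw [← TangentBundle.continuousLinearMapAt_trivializationAt hx]
  exact Trivialization.continuousLinearMapAt_symmL (R := ℝ) (trivializationAt
    (EuclideanSpace ℝ (Fin (m + 2))) (TangentSpace (𝓡 (m + 2))) q) (by simpa using hx) v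

theorem constField_self : constField v q = v := by
  rw [← mfderiv_extChartAt_self_apply (constField v q)]
  exact mfderiv_extChartAt_constField (mem_extChartAt_source q)

/-- Near `q` this field agrees with `FiberBundle.extend` of its value at `q`: both have constant
components in the same trivialization. -/
theorem diffFieldAt_constField : DiffFieldAt (constField v) q := by
  have h : constField v =ᶠ[𝓝 q]
      FiberBundle.extend (E := (TangentSpace (𝓡 (m + 2)) : M → Type _)) (x := q)
        (EuclideanSpace ℝ (Fin (m + 2))) (constField v q) := by
    filter_upwards [chart_source_mem_nhds (EuclideanSpace ℝ (Fin (m + 2))) q] with x hx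
    have key : ∀ a : EuclideanSpace ℝ (Fin (m + 2)),
        (trivializationAt (EuclideanSpace ℝ (Fin (m + 2))) (TangentSpace (𝓡 (m + 2))) q).symmL ℝ x
          a = FiberBundle.extend (E := (TangentSpace (𝓡 (m + 2)) : M → Type _)) (x := q)
        (EuclideanSpace ℝ (Fin (m + 2)))
        ((trivializationAt (EuclideanSpace ℝ (Fin (m + 2))) (TangentSpace (𝓡 (m + 2))) q).symmL ℝ q
          a)
        x := fun a => by
      rw [FiberBundle.extend, Trivialization.symmL_apply _ (by simpa using hx),
        Trivialization.symmL_apply _ (by simp), Trivialization.apply_mk_symm _ (by simp)]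
    exact key v
  exact (FiberBundle.mdifferentiableAt_extend (𝓡 (m + 2)) _
    (constField v q)).congr_of_eventuallyEq (h.mono fun x hx => congrArg (TotalSpace.mk' _ x) hx)

/-- In coordinates the bracket is the derivative of the constant field along `X`, which is zero,
minus the derivative of `X` along `v`. -/
theorem mlieBracket_constField :
    mlieBracket (𝓡 (m + 2)) X (constField v) q =
      -chartFieldDeriv X q v := by
  have hconst : chartField (constField v) q =ᶠ[𝓝 (extChartAt (𝓡 (m + 2)) q q)] fun _ => v := by
    filter_upwards [extChartAt_target_mem_nhds (I := 𝓡 (m + 2)) q] with z hz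
    have hz' := (extChartAt (𝓡 (m + 2)) q).map_target hz
    have := chartField_extChartAt (X := constField v) hz'
    rw [(extChartAt (𝓡 (m + 2)) q).right_inv hz] at this
    rw [this]
    exact mfderiv_extChartAt_constField hz'
  rw [← mlieBracketWithin_univ, mlieBracketWithin_apply, mfderiv_extChartAt_self]
  rw [preimage_univ, univ_inter]
  change ContinuousLinearMap.inverse (ContinuousLinearMap.id ℝ (EuclideanSpace ℝ (Fin (m + 2))))
    (lieBracketWithin ℝ (chartField X q) (chartField (constField v) q) (range (𝓡 (m + 2)))
      (extChartAt (𝓡 (m + 2)) q q)) = _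
  rw [ContinuousLinearMap.inverse_id, ModelWithCorners.range_eq_univ, lieBracketWithin_univ,
    lieBracket, hconst.fderiv_eq, hconst.self_of_nhds]
  have h0 : fderiv ℝ (fun _ : EuclideanSpace ℝ (Fin (m + 2)) =>
      (v : EuclideanSpace ℝ (Fin (m + 2)))) (extChartAt (𝓡 (m + 2)) q q) = 0 :=
    fderiv_const_apply _
  exact (congrArg (fun A => A (chartField X q (extChartAt (𝓡 (m + 2)) q q)) -
    chartFieldDeriv X q v) h0).trans (zero_sub _)

end ChartField

/-! ### Lie transport along integral curves and the Lie derivative of the metric. -/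

section Transport

variable {X : ∀ x : M, TangentSpace (𝓡 (m + 2)) x} {γ : ℝ → M} {t₀ : ℝ}

/-- The vectors `c t` along the curve `γ` satisfy, at `t₀`, the equation of Lie transport by `X`:
in the chart at `γ t₀`, their derivative is `DX · c`. -/
def IsLieTransportedAt (X : ∀ x : M, TangentSpace (𝓡 (m + 2)) x) (γ : ℝ → M)
    (c : ∀ t, TangentSpace (𝓡 (m + 2)) (γ t)) (t₀ : ℝ) : Prop :=
  HasDerivAt (F := EuclideanSpace ℝ (Fin (m + 2)))
    (fun t => mfderiv (𝓡 (m + 2)) 𝓘(ℝ, EuclideanSpace ℝ (Fin (m + 2)))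
      (extChartAt (𝓡 (m + 2)) (γ t₀)) (γ t) (c t))
    (chartFieldDeriv X (γ t₀) (c t₀)) t₀

/-- The Lie derivative `L_X g`, in terms of the Levi-Civita connection. -/
def LorentzianMetric.lieDeriv (g : LorentzianMetric m M)
    (X : ∀ x : M, TangentSpace (𝓡 (m + 2)) x) (x : M) (v w : TangentSpace (𝓡 (m + 2)) x) : ℝ :=
  g.inner x (leviCivita g X x v) w + g.inner x v (leviCivita g X x w)

/-- Metric compatibility, with `∇_X V = ∇_V X + [X, V]` and `[X, V] = -DX v` for the constant field
`V`. The `DX` terms are arranged to cancel those coming from Lie transport. -/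
theorem mvfderiv_inner_constField (g : LorentzianMetric m M) {q : M} (hX : DiffFieldAt X q)
    (v w : TangentSpace (𝓡 (m + 2)) q) :
    mvfderiv (𝓡 (m + 2)) (fun x => g.inner x (constField v x) (constField w x)) q (X q) =
      g.lieDeriv X q v w - g.inner q (chartFieldDeriv X q v) w -
        g.inner q v (chartFieldDeriv X q w) := by
  have hv : DiffFieldAt (constField v) q := diffFieldAt_constField
  have hw : DiffFieldAt (constField w) q := diffFieldAt_constField
  have hLC := isLeviCivita_leviCivita g
  have key : ∀ u, leviCivita g (constField u) q (X q) = leviCivita g X q u -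
      chartFieldDeriv X q u := fun u => by
    have := hLC.torsion_free X (constField u) q hX diffFieldAt_constField
    rw [mlieBracket_constField, constField_self, sub_eq_iff_eq_add] at this
    rw [this]
    abel
  rw [hLC.metric X _ _ q hv hw, key, key, constField_self, constField_self,
    LorentzianMetric.lieDeriv]
  simp only [map_sub, _root_.sub_apply]
  ring

/-- The derivative of the product of two Lie transported vector fields along an integral curve of
`X` is given by the Lie derivative `L_X g`. -/
theorem IsLieTransportedAt.hasDerivAt_inner (g : LorentzianMetric m M)
    {c d : ∀ t, TangentSpace (𝓡 (m + 2)) (γ t)} (hX : DiffFieldAt X (γ t₀))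
    (hγ : HasMFDerivAt 𝓘(ℝ, ℝ) (𝓡 (m + 2)) γ t₀ ((1 : ℝ →L[ℝ] ℝ).smulRight (X (γ t₀))))
    (hc : IsLieTransportedAt X γ c t₀) (hd : IsLieTransportedAt X γ d t₀) :
    HasDerivAt (fun t => g.inner (γ t) (c t) (d t)) (g.lieDeriv X (γ t₀) (c t₀) (d t₀)) t₀ := by
  let q := γ t₀
  let τ := trivializationAt (EuclideanSpace ℝ (Fin (m + 2))) (TangentSpace (𝓡 (m + 2))) q
  -- The metric along `γ`, in the trivialization at `γ t₀`. The spaces `T_{γ t} M` vary with `t`, so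
  -- `G` and its derivative `G'` are typed on the fixed model space.
  let G : ℝ → EuclideanSpace ℝ (Fin (m + 2)) →L[ℝ] EuclideanSpace ℝ (Fin (m + 2)) →L[ℝ] ℝ :=
    fun t => (ContinuousLinearMap.precomp ℝ (τ.symmL ℝ (γ t))) ∘L g.inner (γ t) ∘L
      τ.symmL ℝ (γ t)
  let A : TangentSpace (𝓡 (m + 2)) q →L[ℝ] TangentSpace (𝓡 (m + 2)) q :=
    leviCivita g X q - chartFieldDeriv X q
  let B : TangentSpace (𝓡 (m + 2)) q →L[ℝ] TangentSpace (𝓡 (m + 2)) q →L[ℝ] ℝ :=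
    g.inner q ∘L A + ContinuousLinearMap.precomp ℝ A ∘L g.inner q
  have hB : ∀ v w, B v w = g.lieDeriv X q v w - g.inner q (chartFieldDeriv X q v) w -
        g.inner q v (chartFieldDeriv X q w) := fun v w => by
    have : B v w = g.inner q (leviCivita g X q v - chartFieldDeriv X q v) w +
        g.inner q v (leviCivita g X q w - chartFieldDeriv X q w) := rfl
    rw [this, map_sub, map_sub, _root_.sub_apply, LorentzianMetric.lieDeriv]
    ring
  let G' : EuclideanSpace ℝ (Fin (m + 2)) →L[ℝ] EuclideanSpace ℝ (Fin (m + 2)) →L[ℝ] ℝ := B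
  have hG : HasDerivAt G G' t₀ := by
    refine hasDerivAt_clm_of_forall_apply fun a => hasDerivAt_clm_of_forall_apply fun b => ?_
    have hf : MDifferentiableAt (𝓡 (m + 2)) 𝓘(ℝ, ℝ)
      (fun x => g.inner x (constField (q := q) a x) (constField (q := q) b x)) q :=
      g.mdiffAt diffFieldAt_constField diffFieldAt_constField
    have h1 : HasFDerivAt (fun t => g.inner (γ t) (constField (q := q) a (γ t))
        (constField (q := q) b (γ t))) (_ : ℝ →L[ℝ] ℝ) t₀ :=
      (hf.hasMFDerivAt.comp t₀ hγ).hasFDerivAt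
    have h2 := (mvfderiv_inner_constField g hX a b).trans (hB a b).symm
    refine h1.hasDerivAt.congr_deriv (Eq.trans ?_ h2)
    change mfderiv (𝓡 (m + 2)) 𝓘(ℝ, ℝ)
      (fun x => g.inner x (constField (q := q) a x) (constField (q := q) b x)) q
      ((1 : ℝ) • X q) = _
    rw [one_smul]
    rfl
  -- Product rule for `G(c, d)`: the derivatives `DX c` and `DX d` cancel the `DX` terms of `G'` and
  -- leave `L_X g`.
  have h3 := (hG.clm_apply hc).clm_apply hd
  have hin : ∀ᶠ t in 𝓝 t₀, γ t ∈ (extChartAt (𝓡 (m + 2)) q).source :=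
    hγ.continuousAt (extChartAt_source_mem_nhds (I := 𝓡 (m + 2)) q)
  refine (h3.congr_of_eventuallyEq ?_).congr_deriv ?_
  · filter_upwards [hin] with t ht
    change g.inner (γ t) (c t) (d t) = g.inner (γ t) (τ.symmL ℝ (γ t) _) (τ.symmL ℝ (γ t) _)
    rw [symmL_mfderiv_extChartAt _ ht, symmL_mfderiv_extChartAt _ ht]
  · have hG₀ : ∀ v w : TangentSpace (𝓡 (m + 2)) q, G t₀ v w = g.inner q v w := fun v w => by
      change g.inner q (constField v q) (constField w q) = _
      rw [constField_self, constField_self]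
    have key : ∀ a b : EuclideanSpace ℝ (Fin (m + 2)), a = c t₀ → b = d t₀ →
        (G' a + G t₀ (chartFieldDeriv X q (c t₀))) b + G t₀ a (chartFieldDeriv X q (d t₀)) =
          g.lieDeriv X (γ t₀) (c t₀) (d t₀) := by
      rintro _ _ rfl rfl
      change B (c t₀) (d t₀) + G t₀ (chartFieldDeriv X q (c t₀)) (d t₀) +
        G t₀ (c t₀) (chartFieldDeriv X q (d t₀)) = _
      rw [hB, hG₀, hG₀]
      ring
    exact key _ _ (mfderiv_extChartAt_self_apply _) (mfderiv_extChartAt_self_apply _)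

theorem hasDerivAt_extChartAt_comp {q : M} {v : TangentSpace (𝓡 (m + 2)) (γ t₀)}
    (hγ : HasMFDerivAt 𝓘(ℝ, ℝ) (𝓡 (m + 2)) γ t₀ ((1 : ℝ →L[ℝ] ℝ).smulRight v))
    (hq : γ t₀ ∈ (extChartAt (𝓡 (m + 2)) q).source) :
    HasDerivAt (F := EuclideanSpace ℝ (Fin (m + 2))) (fun t => extChartAt (𝓡 (m + 2)) q (γ t))
      (mfderiv (𝓡 (m + 2)) 𝓘(ℝ, EuclideanSpace ℝ (Fin (m + 2))) (extChartAt (𝓡 (m + 2)) q)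
        (γ t₀) v) t₀ := by
  have h := mdifferentiableAt_extChartAt (I := 𝓡 (m + 2)) (by rwa [extChartAt_source] at hq)
  have h1 : HasFDerivAt (fun t => extChartAt (𝓡 (m + 2)) q (γ t))
      (_ : ℝ →L[ℝ] EuclideanSpace ℝ (Fin (m + 2))) t₀ :=
    (h.hasMFDerivAt.comp t₀ hγ).hasFDerivAt
  refine h1.hasDerivAt.congr_deriv ?_
  change mfderiv (𝓡 (m + 2)) 𝓘(ℝ, EuclideanSpace ℝ (Fin (m + 2))) (extChartAt (𝓡 (m + 2)) q)
        (γ t₀) ((1 : ℝ) • v) = _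
  rw [one_smul]

/-- Chain rule: along an integral curve, the coordinate derivative of `X` is `DX` applied to the
velocity `X`. -/
theorem isLieTransportedAt_self (hX : DiffFieldAt X (γ t₀))
    (hγ : HasMFDerivAt 𝓘(ℝ, ℝ) (𝓡 (m + 2)) γ t₀ ((1 : ℝ →L[ℝ] ℝ).smulRight (X (γ t₀)))) :
    IsLieTransportedAt X γ (fun t => X (γ t)) t₀ := by
  have h1 := hasDerivAt_extChartAt_comp hγ (mem_extChartAt_source (I := 𝓡 (m + 2)) (γ t₀))
  have h2 := (differentiableAt_chartField hX).hasFDerivAt.comp_hasDerivAt t₀ h1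
  rw [mfderiv_extChartAt_self_apply] at h2
  refine HasDerivAt.congr_of_eventuallyEq h2 ?_
  filter_upwards [hγ.continuousAt (extChartAt_source_mem_nhds (I := 𝓡 (m + 2)) (γ t₀))] with t ht
  exact (chartField_extChartAt ht).symm

theorem IsLocalFlow.hasMFDerivAt {U V : Set M} {J : Set ℝ} {φ : ℝ → M → M}
    (h : IsLocalFlow X U J V φ) {t : ℝ} (ht : t ∈ J) {y : M} (hy : y ∈ V) :
    HasMFDerivAt 𝓘(ℝ, ℝ) (𝓡 (m + 2)) (fun t => φ t y) t
      ((1 : ℝ →L[ℝ] ℝ).smulRight (X (φ t y))) :=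
  (h.integralCurve y hy t ht).hasMFDerivAt (h.isOpen_time.mem_nhds ht)

theorem IsLocalFlow.mdifferentiableAt {U V : Set M} {J : Set ℝ} {φ : ℝ → M → M}
    (h : IsLocalFlow X U J V φ) {t : ℝ} (ht : t ∈ J) {y : M} (hy : y ∈ V) :
    MDifferentiableAt (𝓡 (m + 2)) (𝓡 (m + 2)) (φ t) y := by
  have hφ : ContMDiffAt (𝓘(ℝ, ℝ).prod (𝓡 (m + 2))) (𝓡 (m + 2)) ∞
      (fun q : ℝ × M => φ q.1 q.2) (t, y) :=
    h.smooth.contMDiffAt ((h.isOpen_time.prod h.isOpen_space).mem_nhds ⟨ht, hy⟩)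
  exact (hφ.comp_of_eq (contMDiffAt_const.prodMk contMDiffAt_id) rfl).mdifferentiableAt (by simp)

/-- The flow map pushes a tangent vector forward to a Lie transported vector field. -/
theorem IsLocalFlow.isLieTransportedAt_mfderiv {U V : Set M} {J : Set ℝ} {φ : ℝ → M → M}
    (h : IsLocalFlow X U J V φ) (ht : t₀ ∈ J) {y : M} (hy : y ∈ V) (hX : DiffFieldAt X (φ t₀ y))
    (w : TangentSpace (𝓡 (m + 2)) y) :
    IsLieTransportedAt X (fun t => φ t y)
      (fun t => mfderiv (𝓡 (m + 2)) (𝓡 (m + 2)) (φ t) y w) t₀ := by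
  let q := φ t₀ y
  -- The flow in two charts that do not move with `t`, at `y` and at `q = φ t₀ y`; the equation of
  -- variation applies to it.
  let Φ : ℝ × EuclideanSpace ℝ (Fin (m + 2)) → EuclideanSpace ℝ (Fin (m + 2)) := fun p =>
    extChartAt (𝓡 (m + 2)) q (φ p.1 ((extChartAt (𝓡 (m + 2)) y).symm p.2))
  let z₀ := extChartAt (𝓡 (m + 2)) y y
  have hz₀ : (extChartAt (𝓡 (m + 2)) y).symm z₀ = y := extChartAt_to_inv y
  have hsymm : ContMDiffAt 𝓘(ℝ, EuclideanSpace ℝ (Fin (m + 2))) (𝓡 (m + 2)) ∞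
      (extChartAt (𝓡 (m + 2)) y).symm z₀ :=
    (contMDiffOn_extChartAt_symm y).contMDiffAt (extChartAt_target_mem_nhds y)
  have hφ : ContMDiffAt (𝓘(ℝ, ℝ).prod (𝓡 (m + 2))) (𝓡 (m + 2)) ∞
      (fun q : ℝ × M => φ q.1 q.2) (t₀, y) :=
    h.smooth.contMDiffAt ((h.isOpen_time.prod h.isOpen_space).mem_nhds ⟨ht, hy⟩)
  have hΦ : ContDiffAt ℝ 2 Φ (t₀, z₀) := by
    have h1 : ContMDiffAt (𝓘(ℝ, ℝ).prod 𝓘(ℝ, EuclideanSpace ℝ (Fin (m + 2))))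
        (𝓘(ℝ, ℝ).prod (𝓡 (m + 2))) ∞ (fun p : ℝ × EuclideanSpace ℝ (Fin (m + 2)) =>
          (p.1, (extChartAt (𝓡 (m + 2)) y).symm p.2)) (t₀, z₀) :=
      contMDiffAt_fst.prodMk (hsymm.comp (t₀, z₀) contMDiffAt_snd)
    have h2 : ContMDiffAt (𝓘(ℝ, ℝ).prod 𝓘(ℝ, EuclideanSpace ℝ (Fin (m + 2))))
        𝓘(ℝ, EuclideanSpace ℝ (Fin (m + 2))) ∞ Φ (t₀, z₀) :=
      (contMDiffAt_extChartAt (I := 𝓡 (m + 2)) (x := q)).comp_of_eq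
        (hφ.comp_of_eq h1 (by simp [z₀])) (by simp [z₀, q])
    rw [← modelWithCornersSelf_prod, chartedSpaceSelf_prod] at h2
    exact h2.contDiffAt.of_le (by norm_cast)
  have hsrc : ∀ᶠ p in 𝓝 (t₀, y), φ p.1 p.2 ∈ (extChartAt (𝓡 (m + 2)) q).source :=
    hφ.continuousAt (extChartAt_source_mem_nhds (I := 𝓡 (m + 2)) q)
  have hsrc' : ∀ᶠ t in 𝓝 t₀, φ t y ∈ (extChartAt (𝓡 (m + 2)) q).source :=
    (Continuous.prodMk_left y).tendsto t₀ |>.eventually hsrc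
  have hflow : ∀ᶠ p in 𝓝 (t₀, z₀), HasDerivAt (fun t => Φ (t, p.2)) (chartField X q (Φ p)) p.1 := by
    have htend : Filter.Tendsto (fun p : ℝ × EuclideanSpace ℝ (Fin (m + 2)) =>
        (p.1, (extChartAt (𝓡 (m + 2)) y).symm p.2)) (𝓝 (t₀, z₀)) (𝓝 (t₀, y)) := by
      have := continuousAt_fst.prodMk (hsymm.continuousAt.comp_of_eq
        (continuousAt_snd (p := (t₀, z₀))) rfl)
      simpa [ContinuousAt, z₀] using this
    filter_upwards [htend.eventually hsrc, htend.eventually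
      ((h.isOpen_time.prod h.isOpen_space).mem_nhds ⟨ht, hy⟩)] with p hp hp'
    have := hasDerivAt_extChartAt_comp (h.hasMFDerivAt hp'.1 hp'.2) hp
    rw [← chartField_extChartAt hp] at this
    exact this
  have hX' : DifferentiableAt ℝ (chartField X q) (Φ (t₀, z₀)) := by
    have : Φ (t₀, z₀) = extChartAt (𝓡 (m + 2)) q q := by simp [Φ, z₀, q]
    rw [this]
    exact differentiableAt_chartField hX
  -- The derivative of a map at `y` is computed in the chart at `y`, so the same `w` appears on both
  -- sides.
  have hfd : ∀ᶠ t in 𝓝 t₀, fderiv ℝ (fun z => Φ (t, z)) z₀ w =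
      mfderiv (𝓡 (m + 2)) 𝓘(ℝ, EuclideanSpace ℝ (Fin (m + 2))) (extChartAt (𝓡 (m + 2)) q) (φ t y)
        (mfderiv (𝓡 (m + 2)) (𝓡 (m + 2)) (φ t) y w) := by
    filter_upwards [hsrc', h.isOpen_time.mem_nhds ht] with t ht' htJ
    have h1 : MDifferentiableAt (𝓡 (m + 2)) 𝓘(ℝ, EuclideanSpace ℝ (Fin (m + 2)))
        (extChartAt (𝓡 (m + 2)) q) (φ t y) :=
      mdifferentiableAt_extChartAt (by rwa [extChartAt_source] at ht')
    have h2 := h.mdifferentiableAt htJ hy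
    have h3 := mfderiv_comp y h1 h2
    have h4 := (h1.comp y h2).mvfderiv
    rw [ModelWithCorners.range_eq_univ, fderivWithin_univ] at h4
    have h5 := DFunLike.congr_fun (h4.symm.trans h3) w
    exact h5
  have key := hasDerivAt_fderiv_flow_apply hΦ hX' hflow w
  refine HasDerivAt.congr_deriv (key.congr_of_eventuallyEq (hfd.mono fun t ht => ht.symm)) ?_
  rw [hfd.self_of_nhds, mfderiv_extChartAt_self_apply]
  change fderiv ℝ (chartField X q) (extChartAt (𝓡 (m + 2)) q
    (φ t₀ ((extChartAt (𝓡 (m + 2)) y).symm z₀))) _ = _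
  rw [hz₀]
  rfl

end Transport

/-! ### The shear scalar as a sum of squares. -/

section Shear

variable {g : LorentzianMetric m M} {x : M} {X Y : TangentSpace (𝓡 (m + 2)) x}
  {Z : Fin m → TangentSpace (𝓡 (m + 2)) x}

namespace LorentzianMetric.IsAdapted

/-- The expansion of a vector orthogonal to `X` in an adapted frame. -/
theorem exists_eq_add_sum (h : g.IsAdapted X Y Z) {v : TangentSpace (𝓡 (m + 2)) x}
    (hv : g.inner x X v = 0) : ∃ a : ℝ, v = a • X + ∑ i, g.inner x (Z i) v • Z i := by
  obtain ⟨w, rfl⟩ := h.frameEquiv.surjective v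
  rw [frameEquiv_apply] at *
  have h1 : w 1 = 0 := by rw [← h.inner_left_frameMap w, hv]
  refine ⟨w 0, ?_⟩
  simp only [h.inner_space_frameMap w h1]
  simp [frameMap_apply, h1]

/-- In the basis `X, Y, Zᵢ`, the condition `f X = 0` kills the first diagonal entry. The second is
the `Y`-component of `f Y`, read off by pairing with `X`, and so vanishes too. -/
theorem trace_eq_sum (h : g.IsAdapted X Y Z)
    {f : TangentSpace (𝓡 (m + 2)) x →ₗ[ℝ] TangentSpace (𝓡 (m + 2)) x} (hfX : f X = 0)
    (hXf : ∀ v, g.inner x X (f v) = 0) :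
    LinearMap.trace ℝ _ f = ∑ i, g.inner x (Z i) (f (Z i)) := by
  let b := (Pi.basisFun ℝ (Fin (m + 2))).map h.frameEquiv
  have hb : ∀ i, b i = frameMap X Y Z (Pi.single i 1) := fun i => by
    simp [b, frameEquiv_apply]
  have h0 : b 0 = X := (hb 0).trans frameMap_nullK
  have hs : ∀ i : Fin m, b i.succ.succ = Z i := fun i => (hb _).trans (frameMap_spaceM i)
  have hrepr : ∀ v, frameMap X Y Z (b.repr v) = v := fun v => by
    have : ⇑(b.repr v) = h.frameEquiv.symm v := by
      ext i
      simp [b]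
    rw [this]
    exact h.frameEquiv.apply_symm_apply v
  have h1 : ∀ v, b.repr (f v) 1 = 0 := fun v =>
    (h.inner_left_frameMap _).symm.trans (by rw [hrepr, hXf])
  rw [LinearMap.trace_eq_matrix_trace ℝ b, Matrix.trace, Fin.sum_univ_succ, Fin.sum_univ_succ]
  simp only [Matrix.diag_apply, LinearMap.toMatrix_apply, h0, hfX, hs]
  have h1' : (b.repr (f (b (Fin.succ 0)))) (Fin.succ 0) = 0 := h1 _
  simp only [h1', map_zero, Finsupp.zero_apply, zero_add]
  refine Finset.sum_congr rfl fun i _ => ?_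
  rw [← h.inner_space_frameMap _ (h1 _) i, hrepr]

/-- If `A X = 0`, `A` takes values in `X^⊥` and the scalar `tr ((A + A^†) A)` vanishes, then the
symmetric part of `A` vanishes on `X^⊥`. -/
theorem symm_part_eq_zero (h : g.IsAdapted X Y Z)
    {A : TangentSpace (𝓡 (m + 2)) x →ₗ[ℝ] TangentSpace (𝓡 (m + 2)) x} (hAX : A X = 0)
    (hXA : ∀ v, g.inner x X (A v) = 0)
    (htr : LinearMap.trace ℝ _ ((A + g.adjoint x A) ∘ₗ A) = 0)
    {v w : TangentSpace (𝓡 (m + 2)) x} (hv : g.inner x X v = 0) (hw : g.inner x X w = 0) :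
    g.inner x (A v) w + g.inner x v (A w) = 0 := by
  set S := A + g.adjoint x A with hS
  have hSg : ∀ v w, g.inner x w (S v) = g.inner x w (A v) + g.inner x (A w) v := fun v w => by
    rw [hS, LinearMap.add_apply, map_add, g.symm x w (g.adjoint x A v), g.inner_adjoint,
      g.symm x v (A w)]
  have hXS : ∀ v, g.inner x X (S v) = 0 := fun v => by
    rw [hSg, hXA, hAX]
    simp
  have hSX : S X = 0 := g.nondegenerate x fun w => by
    rw [g.symm, hSg, hAX, g.symm x (A w), hXA]
    simp
  -- By `exists_eq_add_sum`, `a i j` is the coefficient of `Z j` in `A (Z i)`.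
  let a : Fin m → Fin m → ℝ := fun i j => g.inner x (Z j) (A (Z i))
  have hs : ∀ i j, g.inner x (Z i) (S (Z j)) = a i j + a j i := fun i j => by
    rw [hSg, g.symm x (A (Z i))]
    exact add_comm _ _
  have htr' : ∑ i, ∑ j, a i j * (a i j + a j i) = 0 := by
    rw [h.trace_eq_sum (f := S ∘ₗ A) (by rw [LinearMap.comp_apply, hAX, map_zero])
      fun v => hXS _] at htr
    rw [← htr]
    refine Finset.sum_congr rfl fun i _ => ?_
    obtain ⟨c, hc⟩ := h.exists_eq_add_sum (hXA (Z i))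
    rw [LinearMap.comp_apply]
    conv_rhs => rw [hc]
    simp only [map_add, map_smul, map_sum, hSX, smul_zero, zero_add, smul_eq_mul, hs]
    rfl
  -- Adding the trace identity to itself with `i` and `j` exchanged completes the squares. The signs
  -- are right because `g` is positive on the span of the `Zᵢ`.
  have hsq : ∑ i, ∑ j, (a i j + a j i) ^ 2 = 0 := by
    have h1 : ∑ i, ∑ j, a j i * (a i j + a j i) = 0 := by
      rw [Finset.sum_comm, ← htr']
      exact Finset.sum_congr rfl fun i _ => Finset.sum_congr rfl fun j _ => by ring
    calc ∑ i, ∑ j, (a i j + a j i) ^ 2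
        = ∑ i, ∑ j, a i j * (a i j + a j i) + ∑ i, ∑ j, a j i * (a i j + a j i) := by
          simp only [← Finset.sum_add_distrib]
          exact Finset.sum_congr rfl fun i _ => Finset.sum_congr rfl fun j _ => by ring
      _ = 0 := by rw [htr', h1, add_zero]
  have hz : ∀ i j, a i j + a j i = 0 := fun i j => by
    have h1 := (Finset.sum_eq_zero_iff_of_nonneg
      (fun i _ => Finset.sum_nonneg fun j _ => sq_nonneg (a i j + a j i))).1 hsq i
      (Finset.mem_univ i)
    exact pow_eq_zero_iff two_ne_zero |>.1 ((Finset.sum_eq_zero_iff_of_nonneg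
      (fun j _ => sq_nonneg (a i j + a j i))).1 h1 j (Finset.mem_univ j))
  -- As `S` kills `X` and takes values in `X^⊥`, only the `Zᵢ` components of `v` and `w` contribute.
  rw [add_comm, ← hSg w v]
  obtain ⟨c, hc⟩ := h.exists_eq_add_sum hv
  obtain ⟨d, hd⟩ := h.exists_eq_add_sum hw
  rw [hc, hd]
  simp [hSX, hXS, hs, hz]

end LorentzianMetric.IsAdapted

end Shear

/-! ### Flows of Kundt fields preserve the structure. -/

section KundtField

variable {g : LorentzianMetric m M} {lam : ∀ x : M, Submodule ℝ (TangentSpace (𝓡 (m + 2)) x)}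
  {X : ∀ x : M, TangentSpace (𝓡 (m + 2)) x} {U : Set M} {x : M}

theorem SmoothFieldOn.diffFieldAt (hX : SmoothFieldOn X U) (hU : IsOpen U) (hx : x ∈ U) :
    DiffFieldAt X x :=
  (hX.contMDiffAt (hU.mem_nhds hx)).mdifferentiableAt (by simp)

/-- The covariant derivatives of a null vector field are orthogonal to it. -/
theorem inner_leviCivita_of_null (hX : DiffFieldAt X x)
    (hnull : ∀ᶠ y in 𝓝 x, g.inner y (X y) (X y) = 0) (v : TangentSpace (𝓡 (m + 2)) x) :
    g.inner x (X x) (leviCivita g X x v) = 0 := by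
  obtain ⟨V, -, rfl⟩ := exists_extension x v
  have h := (isLeviCivita_leviCivita g).metric V X X x hX hX
  have h0 : mvfderiv (𝓡 (m + 2)) (fun y => g.inner y (X y) (X y)) x (V x) = 0 := by
    have he : (fun y => g.inner y (X y) (X y)) =ᶠ[𝓝 x] fun _ => (0 : ℝ) := hnull
    change mfderiv (𝓡 (m + 2)) 𝓘(ℝ, ℝ) (fun y => g.inner y (X y) (X y)) x (V x) = 0
    rw [he.mfderiv_eq, mfderiv_const]
    rfl
  rw [h0, g.symm x (leviCivita g X x (V x))] at h
  linarith

namespace IsKundtFieldOn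

theorem inner_self (h : IsKundtFieldOn g lam X U) (hl : IsNullDistribution g lam) (hx : x ∈ U) :
    g.inner x (X x) (X x) = 0 :=
  hl.null x _ (h.mem x hx)

theorem inner_leviCivita_eq_zero (h : IsKundtFieldOn g lam X U) (hl : IsNullDistribution g lam)
    (hU : IsOpen U) (hx : x ∈ U) (v : TangentSpace (𝓡 (m + 2)) x) :
    g.inner x (X x) (leviCivita g X x v) = 0 :=
  inner_leviCivita_of_null (h.smooth.diffFieldAt hU hx)
    (Filter.eventually_of_mem (hU.mem_nhds hx) fun _ hy => h.inner_self hl hy) v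

/-- One term vanishes by the geodesic equation, the other because `X` is null. -/
theorem lieDeriv_self_left (h : IsKundtFieldOn g lam X U) (hl : IsNullDistribution g lam)
    (hU : IsOpen U) (hx : x ∈ U) (v : TangentSpace (𝓡 (m + 2)) x) :
    g.lieDeriv X x (X x) v = 0 := by
  rw [LorentzianMetric.lieDeriv, h.geodesic x hx, h.inner_leviCivita_eq_zero hl hU hx]
  simp

theorem lieDeriv_eq_zero (h : IsKundtFieldOn g lam X U) (hl : IsNullDistribution g lam)
    (hU : IsOpen U) (hx : x ∈ U) {v w : TangentSpace (𝓡 (m + 2)) x}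
    (hv : g.inner x (X x) v = 0) (hw : g.inner x (X x) w = 0) : g.lieDeriv X x v w = 0 := by
  obtain ⟨Y, Z, ha⟩ := g.exists_isAdapted (h.ne_zero x hx) (h.inner_self hl hx)
  refine ha.symm_part_eq_zero (A := (leviCivita g X x).toLinearMap) (h.geodesic x hx)
    (h.inner_leviCivita_eq_zero hl hU hx) ?_ hv hw
  have := h.shear_free x hx
  rw [shearScalar, LinearMap.smul_comp, map_smul, smul_eq_zero] at this
  exact this.resolve_left (by norm_num)

end IsKundtFieldOn

theorem IsLocalFlow.eq_of_hasDerivAt_zero {J V : Set _} {φ : ℝ → M → M} (h : IsLocalFlow X U J V φ)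
    {f : ℝ → ℝ} (hf : ∀ t ∈ J, HasDerivAt f 0 t) {t : ℝ} (ht : t ∈ J) : f t = f 0 :=
  h.isOpen_time.is_const_of_deriv_eq_zero h.ordConnected_time.isPreconnected
    (fun s hs => (hf s hs).differentiableAt.differentiableWithinAt) (fun s hs => (hf s hs).deriv)
    ht h.zero_mem

/-- A Kundt vector field is an infinitesimal automorphism of `P(M, g, λ)`. -/
theorem IsKundtFieldOn.isInfinitesimalAutomorphismOn (h : IsKundtFieldOn g lam X U)
    (hl : IsNullDistribution g lam) (hU : IsOpen U) :
    IsInfinitesimalAutomorphismOn (inducedGNStructure g lam) X U := by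
  intro J V φ hφ t ht y hy u hu
  have hmem : ∀ s ∈ J, φ s y ∈ U := fun s hs => hφ.mapsTo s hs y hy
  have hX : ∀ s ∈ J, DiffFieldAt X (φ s y) := fun s hs => h.smooth.diffFieldAt hU (hmem s hs)
  let D : ∀ s, TangentSpace (𝓡 (m + 2)) y →L[ℝ] TangentSpace (𝓡 (m + 2)) (φ s y) :=
    fun s => mfderiv (𝓡 (m + 2)) (𝓡 (m + 2)) (φ s) y
  have hD₀ : ∀ v : EuclideanSpace ℝ (Fin (m + 2)), D 0 v = v := fun v => by
    have he : φ 0 =ᶠ[𝓝 y] id := Filter.eventually_of_mem (hφ.isOpen_space.mem_nhds hy) hφ.initial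
    exact DFunLike.congr_fun (he.mfderiv_eq.trans mfderiv_id) v
  -- The points `φ 0 y` and `y` are only propositionally equal, so vectors over them are compared in
  -- the model space.
  have hinner : ∀ (z : M) (a b a' b' : EuclideanSpace ℝ (Fin (m + 2))), z = y → a = a' → b = b' →
      g.inner z a b = g.inner y a' b' := by
    rintro _ _ _ _ _ rfl rfl rfl
    rfl
  have hinit : ∀ v w, g.inner (φ 0 y) (D 0 v) (D 0 w) = g.inner y v w := fun v w =>
    hinner _ _ _ _ _ (hφ.initial y hy) (hD₀ v) (hD₀ w)
  have hinit' : ∀ w, g.inner (φ 0 y) (X (φ 0 y)) (D 0 w) = g.inner y (X y) w := fun w =>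
    hinner _ _ _ _ _ (hφ.initial y hy)
      (congrArg (fun z => (X z : EuclideanSpace ℝ (Fin (m + 2)))) (hφ.initial y hy)) (hD₀ w)
  have hD : ∀ w, ∀ s ∈ J, IsLieTransportedAt X (fun t => φ t y) (fun t => D t w) s :=
    fun w s hs => hφ.isLieTransportedAt_mfderiv hs hy (hX s hs) w
  -- `w` is arbitrary here, since `L_X g` vanishes whenever one argument is `X`.
  have hXD : ∀ w, ∀ s ∈ J, g.inner (φ s y) (X (φ s y)) (D s w) = g.inner y (X y) w := by
    intro w s hs
    rw [← hinit' w]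
    refine hφ.eq_of_hasDerivAt_zero
      (f := fun s => g.inner (φ s y) (X (φ s y)) (D s w)) (fun s hs => ?_) hs
    have h1 := hφ.hasMFDerivAt hs hy
    have h2 := IsLieTransportedAt.hasDerivAt_inner (γ := fun t => φ t y) g (hX s hs) h1
      (isLieTransportedAt_self (hX s hs) h1) (hD w s hs)
    exact h2.congr_deriv (h.lieDeriv_self_left hl hU (hmem s hs) _)
  -- By `hXD` the transported vectors stay orthogonal to `X`, where `L_X g` vanishes.
  have hDD : ∀ v w, g.inner y (X y) v = 0 → g.inner y (X y) w = 0 → ∀ s ∈ J,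
      g.inner (φ s y) (D s v) (D s w) = g.inner y v w := by
    intro v w hv hw s hs
    rw [← hinit v w]
    refine hφ.eq_of_hasDerivAt_zero
      (f := fun s => g.inner (φ s y) (D s v) (D s w)) (fun s hs => ?_) hs
    have h2 := IsLieTransportedAt.hasDerivAt_inner (γ := fun t => φ t y) g (hX s hs)
      (hφ.hasMFDerivAt hs hy) (hD v s hs) (hD w s hs)
    exact h2.congr_deriv (h.lieDeriv_eq_zero hl hU (hmem s hs) (by rw [hXD v s hs, hv])
      (by rw [hXD w s hs, hw]))
  have hyU : y ∈ U := hφ.subset hy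
  obtain ⟨huk, hau⟩ := (mem_inducedGNStructure_iff hl).1 hu
  -- the first vector of the frame is a multiple of `X`
  obtain ⟨c, hc⟩ : ∃ c : ℝ, u (nullK m) = c • X y := by
    rw [hl.smooth.eq_span_singleton (h.mem y hyU) (h.ne_zero y hyU)] at huk
    obtain ⟨c, hc⟩ := Submodule.mem_span_singleton.1 huk
    exact ⟨c, hc.symm⟩
  have hc0 : c ≠ 0 := by
    rintro rfl
    exact hau.ne_zero (by rw [hc, zero_smul])
  have hperp : ∀ i, g.inner y (X y) (u (spaceM i)) = 0 := fun i => by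
    have := hau.perp i
    rw [hc, map_smul, _root_.smul_apply, smul_eq_zero] at this
    exact this.resolve_left hc0
  have hpair : g.inner y (X y) (u (nullL m)) = c⁻¹ := by
    have := hau.pairing
    rw [hc, map_smul, _root_.smul_apply, smul_eq_mul] at this
    exact eq_inv_of_mul_eq_one_right this
  -- the transported frame is adapted up to the value of `D s X`
  have had : ∀ s ∈ J, g.IsAdapted (c • X (φ s y)) (D s (u (nullL m)))
      fun i => D s (u (spaceM i)) := fun s hs => by
    refine ⟨?_, ?_, fun i => ?_, fun i j => ?_⟩
    · simp [h.inner_self hl (hmem s hs)]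
    · rw [map_smul, _root_.smul_apply, hXD _ s hs, hpair, smul_eq_mul, mul_inv_cancel₀ hc0]
    · rw [map_smul, _root_.smul_apply, hXD _ s hs, hperp, smul_zero]
    · rw [hDD _ _ (hperp i) (hperp j) s hs, hau.orthonormal]
  have hXy : g.inner y (X y) (X y) = 0 := h.inner_self hl hyU
  have hmul : ∀ s ∈ J, ∃ a : ℝ, D s (X y) = a • X (φ s y) := fun s hs => by
    obtain ⟨a, ha⟩ := (had s hs).exists_smul_eq (v := D s (X y))
      (by rw [map_smul, _root_.smul_apply, hXD _ s hs, hXy, smul_zero])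
      (fun i => by rw [hDD _ _ (hperp i) hXy s hs, g.symm, hperp])
    exact ⟨a * c, by rw [ha, smul_smul]⟩
  -- `IsLocalFlow` includes no group law, so this is drawn from the metric. Since `D s (X y)` is a
  -- multiple of `X`, its pairing with the transported image of `l` is constant in `s`, which forces
  -- the factor to be `1`.
  have hDX : D t (X y) = X (φ t y) := by
    obtain ⟨a, ha⟩ := hmul t ht
    have h1 : g.inner (φ t y) (D t (X y)) (D t (u (nullL m))) = g.inner y (X y) (u (nullL m)) := by
      rw [← hinit]
      refine hφ.eq_of_hasDerivAt_zero
        (f := fun s => g.inner (φ s y) (D s (X y)) (D s (u (nullL m)))) (fun s hs => ?_) ht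
      have h2 := IsLieTransportedAt.hasDerivAt_inner (γ := fun t => φ t y) g (hX s hs)
        (hφ.hasMFDerivAt hs hy) (hD (X y) s hs) (hD (u (nullL m)) s hs)
      refine h2.congr_deriv ?_
      obtain ⟨b, hb⟩ := hmul s hs
      have h3 := h.lieDeriv_self_left hl hU (hmem s hs) (D s (u (nullL m)))
      simp only [hb, LorentzianMetric.lieDeriv, map_smul, _root_.smul_apply, ← smul_add] at h3 ⊢
      rw [h3, smul_zero]
    rw [ha, map_smul, _root_.smul_apply, hXD _ t ht, hpair, smul_eq_mul] at h1
    rw [ha, (mul_eq_right₀ (inv_ne_zero hc0)).1 h1, one_smul]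
  refine ⟨(had t ht).frameEquiv, (had t ht).frameEquiv_mem hl
    (Submodule.smul_mem _ _ (h.mem _ (hmem t ht))), fun v => ?_⟩
  have hfr : frameMap (c • X (φ t y)) (D t (u (nullL m))) (fun i => D t (u (spaceM i))) =
      (D t).toLinearMap ∘ₗ u.toLinearMap := by
    rw [← frameMap_linearEquiv u, ← hDX, hc, ← map_smul]
    refine LinearMap.ext fun w => ?_
    simp [frameMap_apply]
  exact DFunLike.congr_fun hfr v

end KundtField

/-! ### Smooth local sections by Gram–Schmidt. -/

section LocalFrame

/-- A vector field is smooth near the point `p`. -/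
def SmoothFieldNear (X : ∀ x : M, TangentSpace (𝓡 (m + 2)) x) (p : M) : Prop :=
  ∀ᶠ y in 𝓝 p, ContMDiffAt (𝓡 (m + 2)) (𝓡 (m + 2)).tangent ∞
    (fun x => (⟨x, X x⟩ : TangentBundle (𝓡 (m + 2)) M)) y

/-- A function is smooth near the point `p`. -/
def SmoothNear (f : M → ℝ) (p : M) : Prop :=
  ∀ᶠ y in 𝓝 p, ContMDiffAt (𝓡 (m + 2)) 𝓘(ℝ, ℝ) ∞ f y

variable {g : LorentzianMetric m M} {X Y : ∀ x : M, TangentSpace (𝓡 (m + 2)) x} {p : M}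
  {f : M → ℝ}

theorem SmoothNear.continuousAt (hf : SmoothNear (m := m) f p) : ContinuousAt f p :=
  hf.self_of_nhds.continuousAt

theorem SmoothNear.comp {h : ℝ → ℝ} (hf : SmoothNear (m := m) f p)
    (hh : ContDiffOn ℝ ∞ h (Ioi 0)) (hp : 0 < f p) : SmoothNear (m := m) (h ∘ f) p := by
  filter_upwards [hf, hf.continuousAt.eventually (lt_mem_nhds hp)] with y hy hpos
  exact (hh.contDiffAt (Ioi_mem_nhds hpos)).contMDiffAt.comp y hy

theorem SmoothFieldNear.inner (g : LorentzianMetric m M) (hX : SmoothFieldNear X p)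
    (hY : SmoothFieldNear Y p) : SmoothNear (m := m) (fun y => g.inner y (X y) (Y y)) p := by
  filter_upwards [hX, hY] with y hX hY
  have : ContMDiffAt (𝓡 (m + 2)) ((𝓡 (m + 2)).prod 𝓘(ℝ)) ∞
      (fun y => TotalSpace.mk' ℝ (E := Bundle.Trivial M ℝ) y (g.inner y (X y) (Y y))) y := by
    apply ContMDiffAt.clm_bundle_apply₂ (F₁ := EuclideanSpace ℝ (Fin (m + 2)))
      (F₂ := EuclideanSpace ℝ (Fin (m + 2)))
    · exact g.contMDiff.contMDiffAt
    · exact hX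
    · exact hY
  simp only [contMDiffAt_totalSpace] at this
  exact this.2

theorem SmoothFieldNear.smul (hf : SmoothNear (m := m) f p) (hX : SmoothFieldNear X p) :
    SmoothFieldNear (fun y => f y • X y) p := by
  filter_upwards [hf, hX] with y hf hX
  exact hf.smul_section hX

theorem SmoothFieldNear.sub (hX : SmoothFieldNear X p) (hY : SmoothFieldNear Y p) :
    SmoothFieldNear (fun y => X y - Y y) p := by
  filter_upwards [hX, hY] with y hX hY
  exact hX.sub_section hY

theorem SmoothFieldNear.sum {ι : Type*} [Fintype ι]
    {Z : ι → ∀ x : M, TangentSpace (𝓡 (m + 2)) x} (hZ : ∀ i, SmoothFieldNear (Z i) p) :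
    SmoothFieldNear (fun y => ∑ i, Z i y) p := by
  filter_upwards [Filter.eventually_all.2 hZ] with y hZ
  exact ContMDiffAt.sum_section fun i _ => hZ i

theorem exists_smoothFieldNear (v : TangentSpace (𝓡 (m + 2)) p) :
    ∃ V : ∀ x : M, TangentSpace (𝓡 (m + 2)) x, SmoothFieldNear V p ∧ V p = v := by
  obtain ⟨s, hs, h⟩ := FiberBundle.exists_contMDiffOn_extend (k := ∞) (𝓡 (m + 2))
    (EuclideanSpace ℝ (Fin (m + 2))) v
  exact ⟨_, (eventually_mem_nhds_iff.2 hs).mono fun y hy => h.contMDiffAt hy,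
    FiberBundle.extend_apply_self _ v⟩

/-- The Gram–Schmidt process for vector fields orthogonal to a given field `X`, starting from fields
which are orthonormal at one point. -/
theorem exists_orthonormal_fields (g : LorentzianMetric m M) {r : ℕ}
    {W : Fin r → ∀ x : M, TangentSpace (𝓡 (m + 2)) x} (hW : ∀ i, SmoothFieldNear (W i) p)
    (hX : ∀ i, ∀ᶠ y in 𝓝 p, g.inner y (X y) (W i y) = 0)
    (ho : ∀ i j, g.inner p (W i p) (W j p) = if i = j then 1 else 0) :
    ∃ Z : Fin r → ∀ x : M, TangentSpace (𝓡 (m + 2)) x, (∀ i, SmoothFieldNear (Z i) p) ∧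
      (∀ i, ∀ᶠ y in 𝓝 p, g.inner y (X y) (Z i y) = 0) ∧
      (∀ i j, ∀ᶠ y in 𝓝 p, g.inner y (Z i y) (Z j y) = if i = j then 1 else 0) ∧
      ∀ i, Z i p = W i p := by
  induction r with
  | zero => exact ⟨W, hW, hX, fun i => i.elim0, fun i => i.elim0⟩
  | succ r ih =>
    obtain ⟨Z, hZ, hXZ, hZZ, hZp⟩ := ih (W := fun i => W i.castSucc) (fun i => hW _)
      (fun i => hX _) fun i j => by simpa using ho i.castSucc j.castSucc
    let w := W (Fin.last r)
    let V : ∀ x : M, TangentSpace (𝓡 (m + 2)) x := fun y =>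
      w y - ∑ i, g.inner y (w y) (Z i y) • Z i y
    have hV : SmoothFieldNear V p := (hW _).sub (.sum fun i => .smul ((hW _).inner g (hZ i)) (hZ i))
    -- The induction carries `Z i p = W i p` so that the correction term vanishes at `p`.
    have hVp : V p = w p := by
      have : ∀ i, g.inner p (w p) (Z i p) = 0 := fun i => by
        rw [hZp, ho, if_neg]
        exact (Fin.castSucc_lt_last i).ne'
      simp [V, this]
    have hVVp : g.inner p (V p) (V p) = 1 := by
      rw [hVp, ho, if_pos rfl]
    -- Since `g(V, V) = 1` at `p`, it stays positive nearby by continuity; definiteness of `g` on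
    -- `X^⊥/X` is not needed.
    let N : M → ℝ := (fun s => (√s)⁻¹) ∘ fun y => g.inner y (V y) (V y)
    have hVV := hV.inner g hV
    have hN : SmoothNear (m := m) N p := by
      refine SmoothNear.comp hVV ?_ (by simp [hVVp])
      refine ContDiffOn.inv (fun s hs => ?_) fun s hs => (Real.sqrt_pos.2 hs).ne'
      exact (Real.contDiffAt_sqrt (ne_of_gt hs)).contDiffWithinAt
    have hpos : ∀ᶠ y in 𝓝 p, 0 < g.inner y (V y) (V y) :=
      hVV.continuousAt.eventually (lt_mem_nhds (by simp [hVVp]))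
    have hXV : ∀ᶠ y in 𝓝 p, g.inner y (X y) (V y) = 0 := by
      filter_upwards [hX (Fin.last r), Filter.eventually_all.2 hXZ] with y h1 h2
      simp [V, w, h1, h2]
    have hZV : ∀ i, ∀ᶠ y in 𝓝 p, g.inner y (Z i y) (V y) = 0 := fun i => by
      filter_upwards [Filter.eventually_all.2 fun j => hZZ i j] with y h
      simp [V, h, g.symm y (Z i y) (w y)]
    refine ⟨Fin.snoc (α := fun _ => ∀ x : M, TangentSpace (𝓡 (m + 2)) x) Z fun y => N y • V y,
      fun i => ?_, fun i => ?_, fun i j => ?_, fun i => ?_⟩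
    · refine Fin.lastCases ?_ (fun i => ?_) i
      · simpa using hV.smul hN
      · simpa using hZ i
    · refine Fin.lastCases ?_ (fun i => ?_) i
      · filter_upwards [hXV] with y h
        simp [h]
      · simpa using hXZ i
    · refine Fin.lastCases ?_ (fun i => ?_) i <;> refine Fin.lastCases ?_ (fun j => ?_) j
      · filter_upwards [hpos] with y h
        simp only [Fin.snoc_last, map_smul, _root_.smul_apply, smul_eq_mul, if_true, N,
          Function.comp_apply]
        rw [← mul_assoc, ← mul_inv, Real.mul_self_sqrt h.le, inv_mul_cancel₀ h.ne']
      · filter_upwards [hZV j] with y h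
        simp [g.symm y (V y), h, (Fin.castSucc_lt_last j).ne']
      · filter_upwards [hZV i] with y h
        simp [h, (Fin.castSucc_lt_last i).ne]
      · simpa using hZZ i j
    · refine Fin.lastCases ?_ (fun i => ?_) i
      · simp only [Fin.snoc_last, N, Function.comp_apply, hVVp]
        simp [hVp, w]
      · simpa using hZp i

variable {lam : ∀ x : M, Submodule ℝ (TangentSpace (𝓡 (m + 2)) x)}

/-- Near each point there is a smooth adapted frame. -/
theorem exists_isAdapted_near (h : IsNullDistribution g lam) (p : M) :
    ∃ (X Y : ∀ x : M, TangentSpace (𝓡 (m + 2)) x) (Z : Fin m → ∀ x : M, TangentSpace (𝓡 (m + 2)) x),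
      SmoothFieldNear X p ∧ SmoothFieldNear Y p ∧ (∀ i, SmoothFieldNear (Z i) p) ∧
      ∀ᶠ y in 𝓝 p, X y ∈ lam y ∧ g.IsAdapted (X y) (Y y) fun i => Z i y := by
  obtain ⟨U, hU, hpU, X', hX', hspan⟩ := h.smooth p
  let X := X' 0
  have hX : SmoothFieldNear X p := by
    filter_upwards [hU.mem_nhds hpU] with y hy
    exact (hX' 0).contMDiffAt (hU.mem_nhds hy)
  have hXlam : ∀ᶠ y in 𝓝 p, X y ∈ lam y := by
    filter_upwards [hU.mem_nhds hpU] with y hy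
    rw [← (hspan y hy).2]
    exact Submodule.subset_span ⟨0, rfl⟩
  obtain ⟨Y₀, Z₀, ha⟩ := g.exists_isAdapted ((hspan p hpU).1.ne_zero 0)
    (h.null p _ hXlam.self_of_nhds)
  obtain ⟨L, hL, hLp⟩ := exists_smoothFieldNear Y₀
  choose W hW hWp using fun i => exists_smoothFieldNear (Z₀ i)
  have hXL := hX.inner g hL
  have hXLp : g.inner p (X p) (L p) = 1 := by rw [hLp]; exact ha.pairing
  let Y : ∀ x : M, TangentSpace (𝓡 (m + 2)) x := fun y => (g.inner y (X y) (L y))⁻¹ • L y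
  have hY : SmoothFieldNear Y p := .smul (SmoothNear.comp hXL
    (contDiffOn_inv ℝ |>.mono fun s hs => ne_of_gt hs) (by simp [hXLp])) hL
  have hXY : ∀ᶠ y in 𝓝 p, g.inner y (X y) (Y y) = 1 := by
    filter_upwards [hXL.continuousAt.eventually_ne (by simp [hXLp] : _ ≠ (0 : ℝ))] with y hy
    simp only [Y, map_smul, smul_eq_mul]
    exact inv_mul_cancel₀ hy
  -- As `g(X, Y) = 1`, this correction makes the fields orthogonal to `X`; it vanishes at `p`, where
  -- they remain orthonormal.
  let W' : Fin m → ∀ x : M, TangentSpace (𝓡 (m + 2)) x := fun i y =>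
    W i y - g.inner y (X y) (W i y) • Y y
  have hWp' : ∀ i, W' i p = Z₀ i := fun i => by
    have : g.inner p (X p) (Z₀ i) = 0 := ha.perp i
    simp [W', hWp, this]
  obtain ⟨Z, hZ, hXZ, hZZ, -⟩ := exists_orthonormal_fields (X := X) g (W := W') (p := p)
    (fun i => (hW i).sub (.smul (hX.inner g (hW i)) hY))
    (fun i => by
      filter_upwards [hXY] with y hy
      simp [W', hy])
    (fun i j => by rw [hWp', hWp', ha.orthonormal])
  refine ⟨X, Y, Z, hX, hY, hZ, ?_⟩
  filter_upwards [hXlam, hXY, Filter.eventually_all.2 hXZ,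
    Filter.eventually_all.2 fun i => Filter.eventually_all.2 (hZZ i)] with y h1 h2 h3 h4
  exact ⟨h1, h.null y _ h1, h2, h3, h4⟩

/-- `P(M, g, λ)` is a `GN`-structure. -/
theorem isGStructure_inducedGNStructure (h : IsNullDistribution g lam) :
    IsGStructure (GN m) (inducedGNStructure g lam) where
  right_invariant _ _ hu _ ha := inducedGNStructure_right_invariant h hu ha
  transitive _ _ hu _ hu' := inducedGNStructure_transitive h hu hu'
  local_sections p := by
    classical
    obtain ⟨X, Y, Z, hX, hY, hZ, ha⟩ := exists_isAdapted_near h p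
    obtain ⟨U, hU, hUo, hpU⟩ := eventually_nhds_iff.1
      (ha.and (hX.and (hY.and (Filter.eventually_all.2 hZ))))
    -- A section is a total function; off `U` any frame of the fibre will do.
    refine ⟨U, hUo, hpU, fun x => if hx : x ∈ U then (hU x hx).1.2.frameEquiv else
      (inducedGNStructure_nonempty h x).some, fun x hx => ?_, fun v => ?_⟩
    · beta_reduce
      rw [dif_pos hx]
      exact (hU x hx).1.2.frameEquiv_mem h (hU x hx).1.1
    · have hs : SmoothFieldOn (fun x => v 0 • X x + v 1 • Y x + ∑ i : Fin m, v i.succ.succ • Z i x)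
          U := fun x hx => by
        obtain ⟨-, h1, h2, h3⟩ := hU x hx
        exact (((h1.const_smul_section).add_section h2.const_smul_section).add_section
          (ContMDiffAt.sum_section fun i _ => (h3 i).const_smul_section)).contMDiffWithinAt
      refine hs.congr fun x hx => ?_
      beta_reduce
      rw [dif_pos hx]
      rfl

end LocalFrame

end

/-! ### The induced structure is a Kundt structure. -/

theorem mainTheorem8 {m : ℕ} {M : Type*} [TopologicalSpace M] [T2Space M]
    [ChartedSpace (EuclideanSpace ℝ (Fin (m + 2))) M] [IsManifold (𝓡 (m + 2)) ∞ M]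
    (g : LorentzianMetric m M) (lam : ∀ x : M, Submodule ℝ (TangentSpace (𝓡 (m + 2)) x))
    (h : IsKundtSpacetime g lam) :
    IsKundtStructure (inducedGNStructure g lam) where
  isGStructure := isGStructure_inducedGNStructure h.isNull
  integrable := by
    rw [assocHyperplane_inducedGNStructure h.isNull]
    exact h.integrable
  exists_automorphism p := by
    obtain ⟨U, hU, hpU, X, hX⟩ := h.exists_kundtField p
    refine ⟨U, hU, hpU, X, hX.smooth, hX.ne_zero, ?_, hX.isInfinitesimalAutomorphismOn h.isNull hU⟩
    rw [assocLine_inducedGNStructure h.isNull]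
    exact hX.mem
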